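/- Let $n\ge 0$ and let $GL_n=GL_n(\mathbb F_2)$ act on the left on $\mathbb F_2[x_1,\dots,x_n]$ (each $x_i$ of degree $1$) by $(\sigma\cdot f)(x_1,\dots,x_n)=f\bigl(\sum_{j}\sigma_{j,1}x_j,\dots,\sum_{j}\sigma_{j,n}x_j\bigr)$. Let $B_n\subset GL_n$ be the subgroup of upper triangular matrices and $\Sigma_n\subset GL_n$ the subgroup of permutation matrices; for $S\subset GL_n$ write $\overline S\in\mathbb F_2[GL_n]$ for the sum of the elements of $S$, and put $e_n=\overline{B}_n\,\overline{\Sigma}_n$ and $M_n=e_n\cdot\mathbb F_2[x_1,\dots,x_n]$. For $1\le k\le n$ let $\omega_k\in\mathbb F_2[x_1,\dots,x_k]$ be the product of all nonzero linear forms in $x_1,\dots,x_k$ over $\mathbb F_2$. Then, as a graded $\mathbb F_2$-vector space, $M_n$ has a basis formed by the elements $$e_n\cdot\omega_1^{i_1-2i_2}\cdots\omega_{n-1}^{i_{n-1}-2i_n}\,\omega_n^{i_n},$$ indexed by the sequences of integers $(i_1,\dots,i_n)$ with $i_1>2i_2>\dots>2^{n-1}i_n\ge 0$. The element with index $(i_1,\dots,i_n)$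 is homogeneous of degree $i_1+\dots+i_n$, and for each $d$ the elements with $i_1+\dots+i_n=d$ span the degree $d$ part of $M_n$. -/

import Mathlib

noncomputable section

namespace SteinbergSummand

open MvPolynomial

/-- The polynomial algebra `F_2[x_1, …, x_n]`; the variable `x_{j+1}` is `X j`, `j : Fin n`. -/
abbrev Poly (n : ℕ) : Type := MvPolynomial (Fin n) (ZMod 2)

/-- The group `GL_n(F_2)`. -/
abbrev GLn (n : ℕ) : Type := Matrix.GeneralLinearGroup (Fin n) (ZMod 2)

/-- The substitution attached to a matrix `σ`: the algebra map with `x_k ↦ ∑_j σ_{j,k} x_j`. -/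
def subst (n : ℕ) (σ : Matrix (Fin n) (Fin n) (ZMod 2)) : Poly n →ₐ[ZMod 2] Poly n :=
  aeval fun k : Fin n => ∑ j : Fin n, C (σ j k) * X j

theorem subst_one (n : ℕ) : subst n 1 = AlgHom.id (ZMod 2) (Poly n) := by
  apply MvPolynomial.algHom_ext
  intro k
  simp only [subst, aeval_X, AlgHom.id_apply]
  rw [Finset.sum_eq_single k]
  · simp
  · intro j _ hj
    simp [Matrix.one_apply_ne hj]
  · simp

theorem subst_mul (n : ℕ) (σ τ : Matrix (Fin n) (Fin n) (ZMod 2)) :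
    subst n (σ * τ) = (subst n σ).comp (subst n τ) := by
  apply MvPolynomial.algHom_ext
  intro k
  simp only [subst, aeval_X, AlgHom.comp_apply, map_sum, map_mul, algHom_C, algebraMap_eq,
    Matrix.mul_apply, Finset.sum_mul, Finset.mul_sum]
  rw [Finset.sum_comm]
  refine Finset.sum_congr rfl fun j _ => Finset.sum_congr rfl fun i _ => ?_
  ring

/-- The left action of `GL_n(F_2)` on `F_2[x_1, …, x_n]`,
`(σ · f)(x_1, …, x_n) = f(∑_j σ_{j,1} x_j, …, ∑_j σ_{j,n} x_j)`. -/
def polyRep (n : ℕ) : Representation (ZMod 2) (GLn n) (Poly n) where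
  toFun σ := (subst n (σ : Matrix (Fin n) (Fin n) (ZMod 2))).toLinearMap
  map_one' := by
    rw [Units.val_one, subst_one]
    rfl
  map_mul' σ τ := by
    rw [Units.val_mul, subst_mul]
    rfl

/-- The group ring `F_2[GL_n]`. -/
abbrev GroupRing (n : ℕ) : Type := MonoidAlgebra (ZMod 2) (GLn n)

open Classical in
/-- The sum in `F_2[GL_n]` of all elements of a subset `S` of `GL_n`. -/
def barSum {n : ℕ} (S : Set (GLn n)) : GroupRing n :=
  ∑ g : GLn n with g ∈ S, MonoidAlgebra.of (ZMod 2) (GLn n) g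

/-- The Borel subgroup of upper triangular matrices (as a subset). -/
def borel (n : ℕ) : Set (GLn n) :=
  {g | ∀ i j : Fin n, j < i → (g : Matrix (Fin n) (Fin n) (ZMod 2)) i j = 0}

/-- The subgroup of permutation matrices (as a subset). -/
def perms (n : ℕ) : Set (GLn n) :=
  {g | ∃ s : Equiv.Perm (Fin n), (g : Matrix (Fin n) (Fin n) (ZMod 2)) = s.permMatrix (ZMod 2)}

/-- The Steinberg idempotent: the sum over the Borel subgroup times the sum over the
permutation matrices. -/
def steinberg (n : ℕ) : GroupRing n := barSum (borel n) * barSum (perms n)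

/-- The operator `f ↦ e_n · f` on `F_2[x_1, …, x_n]`. -/
def steinbergOp (n : ℕ) : Poly n →ₗ[ZMod 2] Poly n :=
  (polyRep n).asAlgebraHom (steinberg n)

/-- The Steinberg summand `M_n = e_n · F_2[x_1, …, x_n]`. -/
def steinbergModule (n : ℕ) : Submodule (ZMod 2) (Poly n) :=
  LinearMap.range (steinbergOp n)

/-- For `k ≤ n`, the element `ω_k` of `F_2[x_1, …, x_k] ⊆ F_2[x_1, …, x_n]`: the product of all
nonzero linear forms in `x_1, …, x_k`. -/
def omega (n k : ℕ) : Poly n :=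
  ∏ v : Fin n → ZMod 2 with v ≠ 0 ∧ ∀ j : Fin n, k ≤ (j : ℕ) → v j = 0,
    ∑ j : Fin n, C (v j) * X j

/-- The sequences of nonnegative integers with `i_1 > 2 i_2 > … > 2^{n-1} i_n (≥ 0)`;
here `i_{k+1}` is `I k` for `k : Fin n`. -/
def Admissible (n : ℕ) : Type :=
  {I : Fin n → ℕ // ∀ j k : Fin n, j < k → 2 ^ (k : ℕ) * I k < 2 ^ (j : ℕ) * I j}

/-- `i_k - 2 i_{k+1}` for `k < n` and `i_n` for `k = n` (the truncated subtraction is exact for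
admissible sequences). -/
def omegaExp {n : ℕ} (I : Admissible n) (k : Fin n) : ℕ :=
  if h : (k : ℕ) + 1 < n then I.1 k - 2 * I.1 ⟨(k : ℕ) + 1, h⟩ else I.1 k

/-- The monomial `ω_1^{i_1 - 2 i_2} ⋯ ω_{n-1}^{i_{n-1} - 2 i_n} ω_n^{i_n}`. -/
def omegaMonomial {n : ℕ} (I : Admissible n) : Poly n :=
  ∏ k : Fin n, omega n ((k : ℕ) + 1) ^ omegaExp I k

/-- The degree `i_1 + ⋯ + i_n`. -/
def Admissible.degree {n : ℕ} (I : Admissible n) : ℕ := ∑ k : Fin n, I.1 k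

end SteinbergSummand

end

/-!
The elements `e_n · ω^I` have pairwise distinct lexicographic leading exponents (`x_1` being the
largest variable), namely the sequences `I` themselves, and the leading exponent of every nonzero
homogeneous element of `M_n` is one of these sequences. Triangularity with respect to the
lexicographic order then gives linear independence and, degree by degree, spanning; no knowledge of
the invariants of the Borel subgroup `B` is needed.

Both facts rest on the relations that characterise `M_n`: its elements `f` are fixed by `B`, and
`f + s f + t s f = 0` for each adjacent transposition `s = s_i` and elementary matrix
`t = 1 + E_{i,i+1}` (`borel_steinberg`, `parabolic_sum_steinberg`). The second relation says that
the sum of `f` over the cosets of `B` in the minimal parabolic subgroup `B ∪ B s B` vanishes.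

* If `f` is homogeneous and satisfies these relations, let `m` be its leading exponent. Keeping the
  terms that agree with `m` outside positions `i` and `i + 1`, and setting `x_i = 1`,
  `x_{i+1} = y`, turns `f` into a polynomial `H(y)` divisible by `y ^ m_{i+1}` and invariant under
  `y ↦ y + 1`, hence divisible by `(y (y + 1)) ^ m_{i+1}`. The second relation writes `H` as
  `G(y) + G(y + 1)` with `deg G ≤ m_i`, so that `2 m_{i+1} ≤ deg H < m_i`
  (`two_mul_lexDegree_lt`).

* Conversely, if a `B`-invariant vector `v` satisfies the second relation modulo a
  subrepresentation `Q`, then `e_n v ≡ v` modulo `Q` (`steinberg_sub_mem`). Indeed only the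
  order-reversing permutation `w` contributes to `∑_σ ∑_b b σ v`, by
  `sum_borel_permElt_eq_zero`, and the sum over the big cell `B w B / B` is built up from smaller
  Bruhat cells, each step being the second relation (`sum_inversionSet_sub_mem`). This is applied
  to `v = ω^I`, with `Q` the polynomials all of whose translates have only terms smaller than
  `x^I`. The relation holds modulo `Q` because the three translates of `ω_i` under `1`, `s`, `t s`
  add up to zero (`omega_parabolic_sum`), because powers in `F_2` do not change leading
  coefficients, and because no translate of `ω_k` has a leading exponent above
  `(2 ^ (k - 1), …, 2, 1, 0, …, 0)` (`lexDegree_polyRep_omega_le`). So `e_n ω^I` has the leading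
  term of `ω^I`, which is `x^I`.
-/

noncomputable section

namespace SteinbergSummand

open MvPolynomial Matrix
open scoped MonomialOrder

/-! ### Permutation and elementary matrices, the Borel subgroup -/

/-- The permutation matrix of `s` as an element of `GL_n(F_2)`; it sends `x_{s k}` to `x_k`, so
`s ↦ permElt s` is an anti-homomorphism. -/
def permElt {n : ℕ} (s : Equiv.Perm (Fin n)) : GLn n where
  val := s.permMatrix (ZMod 2)
  inv := (s⁻¹).permMatrix (ZMod 2)
  val_inv := by rw [← Matrix.permMatrix_mul]; simp
  inv_val := by rw [← Matrix.permMatrix_mul]; simp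

theorem permElt_apply {n : ℕ} (s : Equiv.Perm (Fin n)) (a b : Fin n) :
    (permElt s : Matrix (Fin n) (Fin n) (ZMod 2)) a b = if s a = b then 1 else 0 := by
  simp [permElt, Equiv.Perm.permMatrix, PEquiv.toMatrix_apply, Equiv.toPEquiv_apply, eq_comm]

theorem permElt_mul {n : ℕ} (s t : Equiv.Perm (Fin n)) :
    permElt (s * t) = permElt t * permElt s :=
  Units.ext (Matrix.permMatrix_mul (σ := s) (τ := t))

theorem permElt_one {n : ℕ} : permElt (1 : Equiv.Perm (Fin n)) = 1 :=
  Units.ext Matrix.permMatrix_one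

theorem permElt_injective {n : ℕ} : Function.Injective (permElt (n := n)) := by
  intro s t h
  ext a
  have := congrArg (fun g : GLn n => (g : Matrix (Fin n) (Fin n) (ZMod 2)) a (s a)) h
  simp only [permElt_apply] at this
  by_contra hne
  rw [if_pos trivial, if_neg (fun h => hne (by rw [h]))] at this
  exact one_ne_zero this

/-- The elementary matrix `1 + E_{a,b}` as an element of `GL_n(F_2)`. -/
def transElt {n : ℕ} (a b : Fin n) (h : a ≠ b) : GLn n where
  val := transvection a b 1
  inv := transvection a b 1
  val_inv := by
    rw [transvection_mul_transvection_same a b h, CharTwo.add_self_eq_zero, transvection_zero]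
  inv_val := by
    rw [transvection_mul_transvection_same a b h, CharTwo.add_self_eq_zero, transvection_zero]

theorem mul_transElt_apply {n : ℕ} {a b : Fin n} (h : a ≠ b) (g : GLn n) (i j : Fin n) :
    (↑(g * transElt a b h) : Matrix (Fin n) (Fin n) (ZMod 2)) i j =
      if j = b then g.1 i b + g.1 i a else g.1 i j := by
  change (g.1 * transvection a b 1 : Matrix (Fin n) (Fin n) (ZMod 2)) i j = _
  split_ifs with hj
  · subst hj; simp
  · simp [hj]

theorem transElt_mul_apply {n : ℕ} {a b : Fin n} (h : a ≠ b) (g : GLn n) (i j : Fin n) :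
    (↑(transElt a b h * g) : Matrix (Fin n) (Fin n) (ZMod 2)) i j =
      if i = a then g.1 a j + g.1 b j else g.1 i j := by
  change (transvection a b 1 * g.1 : Matrix (Fin n) (Fin n) (ZMod 2)) i j = _
  split_ifs with hj
  · subst hj; simp
  · simp [hj]

theorem permElt_mul_apply {n : ℕ} (s : Equiv.Perm (Fin n)) (g : GLn n) (i j : Fin n) :
    (↑(permElt s * g) : Matrix (Fin n) (Fin n) (ZMod 2)) i j = g.1 (s i) j := by
  rw [Units.val_mul, Matrix.mul_apply, Finset.sum_eq_single (s i)]
  · rw [permElt_apply, if_pos rfl, one_mul]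
  · intro b _ hb
    rw [permElt_apply, if_neg (Ne.symm hb), zero_mul]
  · simp

theorem mul_permElt_apply {n : ℕ} (s : Equiv.Perm (Fin n)) (g : GLn n) (i j : Fin n) :
    (↑(g * permElt s) : Matrix (Fin n) (Fin n) (ZMod 2)) i (s j) = g.1 i j := by
  rw [Units.val_mul, Matrix.mul_apply, Finset.sum_eq_single j]
  · rw [permElt_apply, if_pos rfl, mul_one]
  · intro b _ hb
    rw [permElt_apply, if_neg (fun h => hb (s.injective h)), mul_zero]
  · simp

theorem transElt_mul_self {n : ℕ} {a b : Fin n} (h : a ≠ b) :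
    transElt a b h * transElt a b h = 1 :=
  Units.ext (transElt a b h).val_inv

theorem permElt_swap_mul_self {n : ℕ} (a b : Fin n) :
    permElt (Equiv.swap a b) * permElt (Equiv.swap a b) = 1 := by
  rw [← permElt_mul, Equiv.swap_mul_self, permElt_one]

/-- Conjugating an elementary matrix by a permutation matrix. -/
theorem transElt_mul_permElt {n : ℕ} {a b : Fin n} (h : a ≠ b) (s : Equiv.Perm (Fin n)) :
    transElt a b h * permElt s = permElt s * transElt (s a) (s b) (s.injective.ne h) := by
  refine Units.ext (Matrix.ext fun i j => ?_)
  rw [transElt_mul_apply, mul_transElt_apply]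
  simp only [permElt_apply, s.injective.eq_iff]
  by_cases hi : i = a <;> by_cases hj : s b = j <;> simp_all [eq_comm]

theorem transElt_mem_borel {n : ℕ} {a b : Fin n} (h : a < b) : transElt a b h.ne ∈ borel n := by
  intro i j hji
  have := mul_transElt_apply h.ne 1 i j
  rw [one_mul] at this
  rw [this]
  simp only [Units.val_one, Matrix.one_apply]
  split_ifs <;> simp_all
  omega

theorem mul_mem_borel {n : ℕ} {g h : GLn n} (hg : g ∈ borel n) (hh : h ∈ borel n) :
    g * h ∈ borel n := by
  intro i j hji
  rw [Units.val_mul, Matrix.mul_apply]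
  refine Finset.sum_eq_zero fun k _ => ?_
  rcases lt_or_ge k i with hk | hk
  · rw [hg i k hk, zero_mul]
  · rw [hh k j (hji.trans_le hk), mul_zero]

theorem borel_diag {n : ℕ} {g : GLn n} (hg : g ∈ borel n) (i : Fin n) : g.1 i i = 1 := by
  have hdet : g.1.det ≠ 0 := Matrix.GeneralLinearGroup.det_ne_zero g
  rw [Matrix.det_of_isUpperTriangular (fun i j hij => hg i j hij), Finset.prod_ne_zero_iff] at hdet
  have := hdet i (Finset.mem_univ i)
  revert this
  generalize g.1 i i = x
  revert x
  decide

theorem inv_mem_borel {n : ℕ} {g : GLn n} (hg : g ∈ borel n) : g⁻¹ ∈ borel n := by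
  intro i j hji
  have h1 : (g⁻¹ : GLn n).1 = (g.1)⁻¹ := Matrix.coe_units_inv g
  have : Invertible g.1 := g.invertible
  have h2 : BlockTriangular g.1 id := fun i j hij => hg i j hij
  have h3 := Matrix.blockTriangular_inv_of_blockTriangular h2
  have := h3 (show id j < id i from hji)
  change (g⁻¹ : GLn n).1 i j = 0
  rw [h1]; exact this

theorem zmod_two_eq_one {x : ZMod 2} (h : x ≠ 0) : x = 1 := by
  revert h; revert x; decide

/-! ### The action of the Steinberg idempotent on a representation -/

section rep
variable {n : ℕ} {N : Type*} [AddCommGroup N] [Module (ZMod 2) N]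

open Classical in
theorem asAlgebraHom_barSum (ρ : Representation (ZMod 2) (GLn n) N) (S : Set (GLn n)) (v : N) :
    ρ.asAlgebraHom (barSum S) v = ∑ g : GLn n with g ∈ S, ρ g v := by
  simp [barSum, map_sum, Representation.asAlgebraHom_single, LinearMap.sum_apply]

theorem asAlgebraHom_barSum_perms (ρ : Representation (ZMod 2) (GLn n) N) (v : N) :
    ρ.asAlgebraHom (barSum (perms n)) v = ∑ s : Equiv.Perm (Fin n), ρ (permElt s) v := by
  classical
  rw [asAlgebraHom_barSum]
  symm
  refine Finset.sum_bij (fun s _ => permElt s) ?_ (fun _ _ _ _ h => permElt_injective h) ?_ ?_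
  · intro s _
    exact Finset.mem_filter.2 ⟨Finset.mem_univ _, s, rfl⟩
  · intro g hg
    obtain ⟨s, hs⟩ := (Finset.mem_filter.1 hg).2
    exact ⟨s, Finset.mem_univ _, Units.ext hs.symm⟩
  · intros; rfl

theorem asAlgebraHom_steinberg (ρ : Representation (ZMod 2) (GLn n) N) (v : N) :
    ρ.asAlgebraHom (steinberg n) v =
      ρ.asAlgebraHom (barSum (borel n)) (∑ s : Equiv.Perm (Fin n), ρ (permElt s) v) := by
  rw [steinberg, map_mul, Module.End.mul_apply, asAlgebraHom_barSum_perms]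

theorem rep_mul_apply (ρ : Representation (ZMod 2) (GLn n) N) (g h : GLn n) (v : N) :
    ρ (g * h) v = ρ g (ρ h v) := by rw [map_mul]; rfl

/-- If `s` is not the order-reversing permutation, then `B ∩ s B s⁻¹` contains an involution, so
that every term of `∑_{b ∈ B} b s v` occurs an even number of times. -/
theorem sum_borel_permElt_eq_zero (ρ : Representation (ZMod 2) (GLn n) N) {v : N}
    (hv : ∀ b ∈ borel n, ρ b v = v) {s : Equiv.Perm (Fin n)} {j k : Fin n} (hjk : j < k)
    (hs : s j < s k) :
    ρ.asAlgebraHom (barSum (borel n)) (ρ (permElt s) v) = 0 := by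
  classical
  rw [asAlgebraHom_barSum]
  refine Finset.sum_involution (fun b _ => b * transElt j k hjk.ne) ?_ ?_ ?_ ?_
  · intro b _
    have : ρ (b * transElt j k hjk.ne) (ρ (permElt s) v) = ρ b (ρ (permElt s) v) := by
      rw [← rep_mul_apply, mul_assoc, transElt_mul_permElt, rep_mul_apply, rep_mul_apply,
        hv _ (transElt_mem_borel hs)]
    rw [this, ZModModule.add_self]
  · intro b _ _ h
    have h1 : transElt j k hjk.ne = 1 := by simpa using h
    have h2 := mul_transElt_apply hjk.ne 1 j k
    rw [one_mul, h1] at h2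
    simp [hjk.ne] at h2
  · intro b hb
    exact Finset.mem_filter.2 ⟨Finset.mem_univ _,
      mul_mem_borel (Finset.mem_filter.1 hb).2 (transElt_mem_borel hjk)⟩
  · intro b _
    simp only [mul_assoc, transElt_mul_self, mul_one]

theorem exists_lt_of_ne_rev {s : Equiv.Perm (Fin n)} (hs : s ≠ Fin.revPerm) :
    ∃ j k, j < k ∧ s j < s k := by
  by_contra! h
  apply hs
  have hanti : StrictAnti s := fun j k hjk =>
    lt_of_le_of_ne (h j k hjk) (s.injective.ne hjk.ne')
  have hm : StrictMono (Fin.rev ∘ s) := fun j k hjk => Fin.rev_lt_rev.2 (hanti hjk)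
  have hi : (Fin.rev ∘ s) = id := by
    have := Subsingleton.elim (α := Fin n ≃o Fin n)
      (StrictMono.orderIsoOfSurjective (Fin.rev ∘ s) hm
        (Fin.rev_surjective.comp s.surjective)) (OrderIso.refl _)
    exact congrArg (fun f : Fin n ≃o Fin n => (f : Fin n → Fin n)) this
  ext j
  have := congrFun hi j
  simp only [Function.comp_apply, id_eq] at this
  rw [Fin.revPerm_apply, ← Fin.rev_rev (s j), this]

/-- `B ∩ s B⁻ s⁻¹`, where `B⁻` is the group of lower triangular matrices and `s` is identified
with its permutation matrix: the upper triangular matrices whose entries above the diagonal vanish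
at the pairs that `s` does not invert. -/
def inversionSet (s : Equiv.Perm (Fin n)) : Set (GLn n) :=
  {b | b ∈ borel n ∧ ∀ j k : Fin n, j < k → b.1 j k ≠ 0 → s k < s j}

theorem inversionSet_one : inversionSet (1 : Equiv.Perm (Fin n)) = {1} := by
  ext b
  constructor
  · rintro ⟨hb, h⟩
    refine Units.ext (Matrix.ext fun j k => ?_)
    rcases lt_trichotomy j k with hjk | rfl | hjk
    · rw [Units.val_one, Matrix.one_apply_ne hjk.ne]
      by_contra hne
      exact absurd (h j k hjk hne) (by simpa using hjk.le)
    · rw [Units.val_one, Matrix.one_apply_eq, borel_diag hb]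
    · rw [Units.val_one, Matrix.one_apply_ne hjk.ne', hb j k hjk]
  · rintro rfl
    refine ⟨fun i j hij => by rw [Units.val_one, Matrix.one_apply_ne hij.ne'], fun j k hjk h => ?_⟩
    rw [Units.val_one, Matrix.one_apply_ne hjk.ne] at h
    exact absurd rfl h

theorem inversionSet_rev : inversionSet (Fin.revPerm : Equiv.Perm (Fin n)) = borel n := by
  ext b
  exact ⟨fun h => h.1, fun h => ⟨h, fun j k hjk _ => by simpa using hjk⟩⟩

theorem swap_succ_lt_iff {i j : Fin n} (hij : (i : ℕ) + 1 = j) {x y : Fin n}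
    (h1 : ¬(x = i ∧ y = j)) (h2 : ¬(x = j ∧ y = i)) :
    Equiv.swap i j x < Equiv.swap i j y ↔ x < y := by
  simp only [Equiv.swap_apply_def, Fin.lt_def, Fin.ext_iff] at *
  split_ifs <;> omega

/-- Multiplying `s` by an adjacent transposition that creates the inversion `(a, c)` enlarges
`inversionSet s` by the root subgroup at position `(a, c)`. -/
theorem mem_inversionSet_swap_iff {i j : Fin n} (hij : (i : ℕ) + 1 = j)
    {s : Equiv.Perm (Fin n)} {a c : Fin n} (ha : s a = i) (hc : s c = j) (hac : a < c) (b : GLn n) :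
    b ∈ inversionSet s ↔ b ∈ inversionSet (Equiv.swap i j * s) ∧ b.1 a c = 0 := by
  have hlt : i < j := by rw [Fin.lt_def]; omega
  constructor
  · rintro ⟨hb, h⟩
    have h0 : b.1 a c = 0 := by
      by_contra hne
      have := h a c hac hne
      rw [ha, hc] at this
      exact absurd hlt this.not_gt
    refine ⟨⟨hb, fun x y hxy hne => ?_⟩, h0⟩
    have := h x y hxy hne
    simp only [Equiv.Perm.mul_apply]
    rw [swap_succ_lt_iff hij]
    · exact this
    · rintro ⟨h1, h2⟩; rw [h1, h2] at this
      rw [← ha] at h1; rw [← hc] at h2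
      rw [s.injective h1, s.injective h2] at hxy
      exact absurd hxy hac.not_gt
    · rintro ⟨h1, h2⟩
      rw [← hc] at h1; rw [← ha] at h2
      rw [s.injective h1, s.injective h2] at hne
      exact hne h0
  · rintro ⟨⟨hb, h⟩, h0⟩
    refine ⟨hb, fun x y hxy hne => ?_⟩
    have := h x y hxy hne
    simp only [Equiv.Perm.mul_apply] at this
    rw [swap_succ_lt_iff hij] at this
    · exact this
    · rintro ⟨h1, h2⟩
      rw [← ha] at h1; rw [← hc] at h2
      rw [s.injective h1, s.injective h2] at hxy
      exact absurd hxy hac.not_gt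
    · rintro ⟨h1, h2⟩
      rw [← hc] at h1; rw [← ha] at h2
      rw [s.injective h1, s.injective h2] at hne
      exact hne h0

theorem mul_transElt_mem_inversionSet {i j : Fin n} (hij : (i : ℕ) + 1 = j)
    {s : Equiv.Perm (Fin n)} {a c : Fin n} (ha : s a = i) (hc : s c = j) (hac : a < c) {b : GLn n}
    (hb : b ∈ inversionSet (Equiv.swap i j * s)) :
    b * transElt a c hac.ne ∈ inversionSet (Equiv.swap i j * s) := by
  refine ⟨mul_mem_borel hb.1 (transElt_mem_borel hac), fun x y hxy hne => ?_⟩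
  rw [mul_transElt_apply] at hne
  split_ifs at hne with hy
  · subst hy
    by_cases h1 : b.1 x y = 0
    · rw [h1, zero_add] at hne
      rcases lt_trichotomy x a with hxa | rfl | hxa
      · have := hb.2 x a hxa hne
        refine lt_trans ?_ this
        simp only [Equiv.Perm.mul_apply, ha, hc, Equiv.swap_apply_left, Equiv.swap_apply_right]
        rw [Fin.lt_def]; omega
      · simp only [Equiv.Perm.mul_apply, ha, hc, Equiv.swap_apply_left, Equiv.swap_apply_right]
        rw [Fin.lt_def]; omega
      · exact absurd (hb.1 x a hxa) hne
    · exact hb.2 x y hxy h1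
  · exact hb.2 x y hxy hne

open Classical in
theorem sum_inversionSet_swap {i j : Fin n} (hij : (i : ℕ) + 1 = j)
    {s : Equiv.Perm (Fin n)} {a c : Fin n} (ha : s a = i) (hc : s c = j) (hac : a < c)
    {A : Type*} [AddCommGroup A] (F : GLn n → A) :
    ∑ b : GLn n with b ∈ inversionSet (Equiv.swap i j * s), F b =
      ∑ b : GLn n with b ∈ inversionSet s, (F b + F (b * transElt a c hac.ne)) := by
  rw [Finset.sum_add_distrib, ← Finset.sum_filter_add_sum_filter_not _ (fun b => b.1 a c = 0)]
  congr 1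
  · refine Finset.sum_congr ?_ fun _ _ => rfl
    ext b
    simp only [Finset.mem_filter, Finset.mem_univ, true_and]
    exact (mem_inversionSet_swap_iff hij ha hc hac b).symm
  · symm
    refine Finset.sum_bij (fun b _ => b * transElt a c hac.ne) ?_ ?_ ?_ ?_
    · intro b hb
      simp only [Finset.mem_filter, Finset.mem_univ, true_and] at hb ⊢
      have hb' := (mem_inversionSet_swap_iff hij ha hc hac b).1 hb
      refine ⟨mul_transElt_mem_inversionSet hij ha hc hac hb'.1, ?_⟩
      rw [mul_transElt_apply, if_pos rfl, hb'.2, borel_diag hb.1]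
      simp
    · intro b _ b' _ h
      exact mul_right_cancel h
    · intro b hb
      simp only [Finset.mem_filter, Finset.mem_univ, true_and] at hb
      refine ⟨b * transElt a c hac.ne, ?_, by rw [mul_assoc, transElt_mul_self, mul_one]⟩
      simp only [Finset.mem_filter, Finset.mem_univ, true_and]
      rw [mem_inversionSet_swap_iff hij ha hc hac]
      refine ⟨mul_transElt_mem_inversionSet hij ha hc hac hb.1, ?_⟩
      rw [mul_transElt_apply, if_pos rfl, zmod_two_eq_one hb.2, borel_diag hb.1.1]
      exact CharTwo.add_self_eq_zero _
    · intros; rfl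

/-- A permutation other than the identity inverts some pair of adjacent values. -/
theorem exists_adjacent_inversion {s : Equiv.Perm (Fin n)} (hs : s ≠ 1) :
    ∃ i j : Fin n, (i : ℕ) + 1 = j ∧ s.symm j < s.symm i := by
  by_contra! h
  apply hs
  have hm : StrictMono s.symm := by
    cases n with
    | zero => intro a; exact a.elim0
    | succ m =>
      rw [Fin.strictMono_iff_lt_succ]
      intro i
      refine lt_of_le_of_ne (h i.castSucc i.succ (by simp)) ?_
      exact s.symm.injective.ne (Fin.castSucc_lt_succ (i := i)).ne
  have := Subsingleton.elim (α := Fin n ≃o Fin n)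
      (StrictMono.orderIsoOfSurjective s.symm hm s.symm.surjective) (OrderIso.refl _)
  have h2 : (s.symm : Fin n → Fin n) = id :=
    congrArg (fun f : Fin n ≃o Fin n => (f : Fin n → Fin n)) this
  ext j
  have := congrFun h2 (s j)
  simpa using congrArg Fin.val this.symm

open Classical in
/-- If the three translates of `v` attached to each minimal parabolic subgroup sum to zero modulo
a subrepresentation `Q`, then summing the translates of `v` over any Bruhat cell `B s B / B` gives
`v` modulo `Q`. The cells are built up one adjacent transposition at a time. -/
theorem sum_inversionSet_sub_mem (ρ : Representation (ZMod 2) (GLn n) N) {v : N}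
    {Q : Submodule (ZMod 2) N} (hQ : ∀ g, ∀ w ∈ Q, ρ g w ∈ Q)
    (h3 : ∀ (i j : Fin n) (hij : (i : ℕ) + 1 = j), v + ρ (permElt (Equiv.swap i j)) v +
      ρ (transElt i j (by rintro rfl; omega)) (ρ (permElt (Equiv.swap i j)) v) ∈ Q)
    (s : Equiv.Perm (Fin n)) :
    (∑ b : GLn n with b ∈ inversionSet s, ρ (b * permElt s) v) - v ∈ Q := by
  -- `∑ l * s l` grows when an inversion of adjacent values is undone
  have hbound : ∀ s : Equiv.Perm (Fin n), ∑ l : Fin n, (l : ℕ) * (s l : ℕ) ≤ n * (n * n) := by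
    intro s
    calc _ ≤ ∑ _l : Fin n, n * n :=
          Finset.sum_le_sum fun l _ => Nat.mul_le_mul l.2.le (s l).2.le
      _ = _ := by simp
  induction hm : n * (n * n) - ∑ l : Fin n, (l : ℕ) * (s l : ℕ) using Nat.strong_induction_on
    generalizing s with
  | _ m ih =>
  by_cases hs : s = 1
  · subst hs
    simp [inversionSet_one, permElt_one, Finset.filter_eq']
  obtain ⟨i, j, hij, hlt⟩ := exists_adjacent_inversion hs
  have hne : i ≠ j := by rintro rfl; omega
  set s' : Equiv.Perm (Fin n) := Equiv.swap i j * s with hs'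
  have hss : Equiv.swap i j * s' = s := by rw [hs', ← mul_assoc, Equiv.swap_mul_self, one_mul]
  have ha : s' (s.symm j) = i := by simp [hs']
  have hc : s' (s.symm i) = j := by simp [hs']
  have hgrow : ∑ l : Fin n, (l : ℕ) * (s l : ℕ) < ∑ l : Fin n, (l : ℕ) * (s' l : ℕ) := by
    have hne' : s.symm j ≠ s.symm i := hlt.ne
    rw [← Finset.add_sum_erase _ _ (Finset.mem_univ (s.symm j)),
      ← Finset.add_sum_erase _ _ (Finset.mem_erase.2 ⟨hne'.symm, Finset.mem_univ (s.symm i)⟩),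
      ← Finset.add_sum_erase _ (fun l : Fin n => (l : ℕ) * (s' l : ℕ))
        (Finset.mem_univ (s.symm j)),
      ← Finset.add_sum_erase _ (fun l : Fin n => (l : ℕ) * (s' l : ℕ))
        (Finset.mem_erase.2 ⟨hne'.symm, Finset.mem_univ (s.symm i)⟩)]
    have hrest : ∑ x ∈ ((Finset.univ.erase (s.symm j)).erase (s.symm i)), (x : ℕ) * (s x : ℕ) =
        ∑ x ∈ ((Finset.univ.erase (s.symm j)).erase (s.symm i)), (x : ℕ) * (s' x : ℕ) := by
      refine Finset.sum_congr rfl fun x hx => ?_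
      simp only [Finset.mem_erase, Finset.mem_univ, and_true] at hx
      rw [hs', Equiv.Perm.mul_apply, Equiv.swap_apply_of_ne_of_ne]
      · rintro h; exact hx.1 (by rw [← h]; simp)
      · rintro h; exact hx.2 (by rw [← h]; simp)
    rw [hrest, ha, hc]
    simp only [Equiv.apply_symm_apply, ← hij]
    rw [Fin.lt_def] at hlt
    nlinarith
  have ih' := ih (n * (n * n) - ∑ l : Fin n, (l : ℕ) * (s' l : ℕ))
    (by have := hbound s'; omega) s' rfl
  have key := sum_inversionSet_swap hij ha hc hlt (fun b => ρ (b * permElt s) v)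
  rw [hss] at key
  have hterm : ∀ b : GLn n, ρ (b * permElt s) v + ρ (b * transElt _ _ hlt.ne * permElt s) v =
      ρ (b * permElt s') v + ρ (b * permElt s') (v + ρ (permElt (Equiv.swap i j)) v +
      ρ (transElt i j hne) (ρ (permElt (Equiv.swap i j)) v)) := by
    intro b
    have e1 : permElt s = permElt s' * permElt (Equiv.swap i j) := by
      rw [← permElt_mul, hss]
    have e2 : b * transElt _ _ hlt.ne * permElt s =
        b * permElt s' * (transElt i j hne * permElt (Equiv.swap i j)) := by
      rw [e1, mul_assoc, ← mul_assoc (transElt _ _ _), transElt_mul_permElt]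
      simp only [ha, hc, mul_assoc]
    rw [e2, e1, ← mul_assoc, rep_mul_apply _ (b * permElt s') (permElt _),
      rep_mul_apply _ (b * permElt s') (transElt _ _ _ * _), rep_mul_apply _ (transElt _ _ _)]
    simp only [map_add]
    rw [← add_assoc, ← add_assoc, ZModModule.add_self, zero_add]
  rw [key, Finset.sum_congr rfl fun b _ => hterm b, Finset.sum_add_distrib, add_sub_right_comm]
  exact Q.add_mem ih' (Q.sum_mem fun b _ => hQ _ _ (h3 i j hij))

/-- The Steinberg idempotent fixes, modulo a subrepresentation `Q`, every `B`-invariant vector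
whose sums over the cosets `P / B` of the minimal parabolic subgroups `P` lie in `Q`. -/
theorem steinberg_sub_mem (ρ : Representation (ZMod 2) (GLn n) N) {v : N}
    {Q : Submodule (ZMod 2) N} (hQ : ∀ g, ∀ w ∈ Q, ρ g w ∈ Q)
    (hv : ∀ b ∈ borel n, ρ b v = v)
    (h3 : ∀ (i j : Fin n) (hij : (i : ℕ) + 1 = j), v + ρ (permElt (Equiv.swap i j)) v +
      ρ (transElt i j (by rintro rfl; omega)) (ρ (permElt (Equiv.swap i j)) v) ∈ Q) :
    ρ.asAlgebraHom (steinberg n) v - v ∈ Q := by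
  classical
  have := sum_inversionSet_sub_mem ρ hQ h3 Fin.revPerm
  rw [inversionSet_rev] at this
  rw [asAlgebraHom_steinberg, map_sum, Finset.sum_eq_single Fin.revPerm, asAlgebraHom_barSum]
  · simpa only [rep_mul_apply] using this
  · intro s _ hs
    obtain ⟨j, k, hjk, hs⟩ := exists_lt_of_ne_rev hs
    exact sum_borel_permElt_eq_zero ρ hv hjk hs
  · simp

theorem borel_steinberg (ρ : Representation (ZMod 2) (GLn n) N) (v : N) {b : GLn n}
    (hb : b ∈ borel n) :
    ρ b (ρ.asAlgebraHom (steinberg n) v) = ρ.asAlgebraHom (steinberg n) v := by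
  classical
  rw [asAlgebraHom_steinberg]
  generalize (∑ s : Equiv.Perm (Fin n), ρ (permElt s) v) = w
  rw [asAlgebraHom_barSum, map_sum]
  refine Finset.sum_bij' (fun g _ => b * g) (fun g _ => b⁻¹ * g) ?_ ?_ ?_ ?_ ?_
  · intro g hg
    simp only [Finset.mem_filter, Finset.mem_univ, true_and] at hg ⊢
    exact mul_mem_borel hb hg
  · intro g hg
    simp only [Finset.mem_filter, Finset.mem_univ, true_and] at hg ⊢
    exact mul_mem_borel (inv_mem_borel hb) hg
  · intros; simp
  · intros; simp
  · intros; rw [rep_mul_apply]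

/-- The minimal parabolic subgroup generated by the Borel subgroup and the transposition of
`i` and `j = i + 1`. -/
def minParabolic (i j : Fin n) : Set (GLn n) :=
  {g | ∀ k l : Fin n, l < k → ¬(k = j ∧ l = i) → g.1 k l = 0}

open Classical in
/-- The decomposition `P = B ⊔ s B ⊔ t s B` of a minimal parabolic subgroup. -/
theorem sum_minParabolic {i j : Fin n} (hij : (i : ℕ) + 1 = j) (hne : i ≠ j)
    {A : Type*} [AddCommGroup A] (F : GLn n → A) :
    ∑ g : GLn n with g ∈ minParabolic i j, F g =
      ∑ b : GLn n with b ∈ borel n, (F b + F (permElt (Equiv.swap i j) * b) +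
        F (transElt i j hne * (permElt (Equiv.swap i j) * b))) := by
  have hlt : i < j := by rw [Fin.lt_def]; omega
  have hss := permElt_swap_mul_self i j
  have htt := transElt_mul_self hne
  have hsw : ∀ (g : GLn n) (k l : Fin n),
      (↑(permElt (Equiv.swap i j) * g) : Matrix (Fin n) (Fin n) (ZMod 2)) k l =
        if k = i then g.1 j l else if k = j then g.1 i l else g.1 k l := by
    intro g k l
    rw [permElt_mul_apply, Equiv.swap_apply_def]
    split_ifs <;> rfl
  rw [Finset.sum_add_distrib, Finset.sum_add_distrib,
    ← Finset.sum_filter_add_sum_filter_not _ (fun g : GLn n => g.1 j i = 0),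
    ← Finset.sum_filter_add_sum_filter_not
      (Finset.filter (fun g : GLn n => ¬ g.1 j i = 0) _) (fun g : GLn n => g.1 i i = 0),
    ← add_assoc]
  congr 1
  · congr 1
    · refine Finset.sum_congr ?_ fun _ _ => rfl
      ext g
      simp only [Finset.mem_filter, Finset.mem_univ, true_and]
      constructor
      · rintro ⟨h1, h2⟩ k l hlk
        by_cases h : k = j ∧ l = i
        · rw [h.1, h.2]; exact h2
        · exact h1 k l hlk h
      · exact fun h => ⟨fun k l hlk _ => h k l hlk, h j i hlt⟩
    · symm
      refine Finset.sum_bij' (fun g _ => permElt (Equiv.swap i j) * g)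
        (fun g _ => permElt (Equiv.swap i j) * g) ?_ ?_ ?_ ?_ ?_
      · intro g hg
        simp only [Finset.mem_filter, Finset.mem_univ, true_and] at hg ⊢
        refine ⟨⟨fun k l hlk hkl => ?_, ?_⟩, ?_⟩
        · rw [hsw]
          split_ifs with h1 h2
          · exact hg _ _ (by rw [← h1] at hlt; exact hlk.trans hlt)
          · refine hg _ _ ?_
            have : l ≠ i := fun h => hkl ⟨h2, h⟩
            rw [h2] at hlk
            simp only [Fin.lt_def, ne_eq, Fin.ext_iff] at *
            omega
          · exact hg _ _ hlk
        · rw [hsw, if_neg hne.symm, if_pos rfl, borel_diag hg]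
          exact one_ne_zero
        · rw [hsw, if_pos rfl]
          exact hg _ _ hlt
      · intro g hg
        simp only [Finset.mem_filter, Finset.mem_univ, true_and] at hg ⊢
        obtain ⟨⟨hg, h1⟩, h0⟩ := hg
        intro k l hlk
        rw [hsw]
        split_ifs with h1 h2
        · refine hg _ _ ?_ ?_
          · rw [← h1] at hlt; exact hlk.trans hlt
          · rintro ⟨-, h⟩; rw [h1, h] at hlk; exact lt_irrefl _ hlk
        · rcases eq_or_ne l i with rfl | h
          · exact h0
          · refine hg _ _ ?_ fun h' => h h'.2
            rw [h2] at hlk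
            simp only [Fin.lt_def, ne_eq, Fin.ext_iff] at *
            omega
        · exact hg _ _ hlk fun h => h2 h.1
      · intro g _; simp only [← mul_assoc, hss, one_mul]
      · intro g _; simp only [← mul_assoc, hss, one_mul]
      · intros; rfl
  · symm
    refine Finset.sum_bij' (fun g _ => transElt i j hne * (permElt (Equiv.swap i j) * g))
      (fun g _ => permElt (Equiv.swap i j) * (transElt i j hne * g)) ?_ ?_ ?_ ?_ ?_
    · intro g hg
      simp only [Finset.mem_filter, Finset.mem_univ, true_and] at hg ⊢
      refine ⟨⟨fun k l hlk hkl => ?_, ?_⟩, ?_⟩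
      · rw [transElt_mul_apply]
        simp only [hsw, if_true, if_neg hne.symm]
        split_ifs with h1 h2
        · rw [h1] at hlk
          rw [hg _ _ (hlk.trans hlt), hg _ _ hlk, add_zero]
        · refine hg _ _ ?_
          have : l ≠ i := fun h => hkl ⟨h2, h⟩
          rw [h2] at hlk
          simp only [Fin.lt_def, ne_eq, Fin.ext_iff] at *
          omega
        · exact hg _ _ hlk
      · rw [transElt_mul_apply, if_neg hne.symm, hsw, if_neg hne.symm, if_pos rfl, borel_diag hg]
        exact one_ne_zero
      · rw [transElt_mul_apply, if_pos rfl, hsw, if_pos rfl, hsw, if_neg hne.symm, if_pos rfl,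
          borel_diag hg, hg _ _ hlt]
        simp
    · intro g hg
      simp only [Finset.mem_filter, Finset.mem_univ, true_and] at hg ⊢
      obtain ⟨⟨hg, h1⟩, h0⟩ := hg
      intro k l hlk
      rw [hsw]
      simp only [transElt_mul_apply, if_true, if_neg hne.symm]
      split_ifs with h1 h2
      · refine hg _ _ ?_ ?_
        · rw [← h1] at hlt; exact hlk.trans hlt
        · rintro ⟨-, h⟩; rw [h1, h] at hlk; exact lt_irrefl _ hlk
      · rcases eq_or_ne l i with rfl | h
        · rw [zmod_two_eq_one h0, zmod_two_eq_one ‹¬ g.1 j l = 0›]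
          exact CharTwo.add_self_eq_zero _
        · rw [h2] at hlk
          rw [hg j l hlk fun h' => h h'.2, add_zero]
          refine hg _ _ ?_ fun h' => h h'.2
          simp only [Fin.lt_def, ne_eq, Fin.ext_iff] at *
          omega
      · exact hg _ _ hlk fun h => h2 h.1
    · intro g _
      simp only [← mul_assoc]
      rw [mul_assoc (permElt _) (transElt _ _ _), htt, mul_one, hss, one_mul]
    · intro g _
      simp only [← mul_assoc]
      rw [mul_assoc (transElt _ _ _) (permElt _), hss, mul_one, htt, one_mul]
    · intros; rfl

/-- The image of the Steinberg idempotent is killed by the sum over `P / B` for each minimal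
parabolic subgroup `P`: that sum turns the factor `∑_{b ∈ B} b` into `∑_{g ∈ P} g`, which is a
multiple of `1 + s` for the transposition `s ∈ P`, and `1 + s` kills the sum over all
permutations. -/
theorem parabolic_sum_steinberg (ρ : Representation (ZMod 2) (GLn n) N) (v : N) {i j : Fin n}
    (hij : (i : ℕ) + 1 = j) (hne : i ≠ j) :
    ρ.asAlgebraHom (steinberg n) v +
      ρ (permElt (Equiv.swap i j)) (ρ.asAlgebraHom (steinberg n) v) +
      ρ (transElt i j hne) (ρ (permElt (Equiv.swap i j)) (ρ.asAlgebraHom (steinberg n) v)) = 0 := by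
  classical
  have hlt : i < j := by rw [Fin.lt_def]; omega
  rw [asAlgebraHom_steinberg]
  have hw : ρ (permElt (Equiv.swap i j)) (∑ s : Equiv.Perm (Fin n), ρ (permElt s) v) =
      ∑ s : Equiv.Perm (Fin n), ρ (permElt s) v := by
    rw [map_sum]
    refine Fintype.sum_equiv (Equiv.mulRight (Equiv.swap i j)) _ _ fun s => ?_
    rw [← rep_mul_apply, ← permElt_mul]
    rfl
  generalize (∑ s : Equiv.Perm (Fin n), ρ (permElt s) v) = w at hw
  rw [asAlgebraHom_barSum]
  simp only [map_sum, ← Finset.sum_add_distrib]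
  have := sum_minParabolic hij hne (fun g => ρ g w)
  simp only [rep_mul_apply] at this
  rw [← this]
  have hss := permElt_swap_mul_self i j
  refine Finset.sum_involution (fun g _ => g * permElt (Equiv.swap i j)) ?_ ?_ ?_ ?_
  · intro g _
    rw [rep_mul_apply, hw, ZModModule.add_self]
  · intro g _ _ h
    have h1 : permElt (Equiv.swap i j) = permElt 1 := by rw [permElt_one]; simpa using h
    have h2 := congrArg (fun s : Equiv.Perm (Fin n) => s i) (permElt_injective h1)
    simp only [Equiv.swap_apply_left, Equiv.Perm.one_apply] at h2
    exact hne h2.symm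
  · intro g hg
    simp only [Finset.mem_filter, Finset.mem_univ, true_and] at hg ⊢
    intro k l hlk hkl
    have := mul_permElt_apply (Equiv.swap i j) g k (Equiv.swap i j l)
    rw [Equiv.swap_apply_self] at this
    rw [this]
    refine hg _ _ ?_ ?_ <;> rw [Equiv.swap_apply_def] <;>
      simp only [Fin.lt_def, Fin.ext_iff] at * <;> split_ifs <;> omega
  · intro g _
    simp only [mul_assoc, hss, mul_one]

end rep

/-! ### The action on polynomials -/

theorem polyRep_apply {n : ℕ} (g : GLn n) (f : Poly n) :
    polyRep n g f = subst n (g : Matrix (Fin n) (Fin n) (ZMod 2)) f := rfl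

theorem polyRep_permElt_X {n : ℕ} (s : Equiv.Perm (Fin n)) (k : Fin n) :
    polyRep n (permElt s) (X k) = X (s.symm k) := by
  simp only [polyRep_apply, subst, aeval_X, permElt_apply]
  rw [Finset.sum_eq_single (s.symm k)]
  · simp
  · intro l _ hl
    rw [if_neg fun h => hl (by rw [← h]; simp), map_zero, zero_mul]
  · simp

theorem polyRep_transElt_X {n : ℕ} {a b : Fin n} (h : a ≠ b) (k : Fin n) :
    polyRep n (transElt a b h) (X k) = if k = b then X b + X a else X k := by
  have key : ∀ l, (transElt a b h).1 l k =
      if k = b then (1 : Matrix (Fin n) (Fin n) (ZMod 2)) l b + (1 : Matrix _ _ _) l a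
      else (1 : Matrix (Fin n) (Fin n) (ZMod 2)) l k := fun l => by
    have := mul_transElt_apply h 1 l k
    rwa [one_mul] at this
  simp only [polyRep_apply, subst, aeval_X, key]
  split_ifs <;> simp [Matrix.one_apply, add_mul, Finset.sum_add_distrib, apply_ite C]

theorem polyRep_mul {n : ℕ} (g : GLn n) (p q : Poly n) :
    polyRep n g (p * q) = polyRep n g p * polyRep n g q := by
  simp only [polyRep_apply, map_mul]

theorem polyRep_isHomogeneous {n d : ℕ} (g : GLn n) {f : Poly n} (hf : f.IsHomogeneous d) :
    (polyRep n g f).IsHomogeneous d := by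
  rw [polyRep_apply, subst, ← one_mul d]
  refine hf.aeval _ fun k => ?_
  refine IsHomogeneous.sum _ _ _ fun j _ => ?_
  rw [← zero_add 1]
  exact (isHomogeneous_C _ _).mul (isHomogeneous_X _ _)

theorem polyRep_homogeneousComponent {n : ℕ} (d : ℕ) (g : GLn n) (f : Poly n) :
    homogeneousComponent d (polyRep n g f) = polyRep n g (homogeneousComponent d f) := by
  conv_lhs => rw [← sum_homogeneousComponent f]
  rw [map_sum, map_sum]
  have : ∀ i, homogeneousComponent d (polyRep n g (homogeneousComponent i f)) =
      if d = i then polyRep n g (homogeneousComponent i f) else 0 := fun i =>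
    homogeneousComponent_of_mem
      (polyRep_isHomogeneous g (homogeneousComponent_isHomogeneous i f))
  simp only [this]
  rw [Finset.sum_ite_eq]
  split_ifs with h
  · rfl
  · rw [homogeneousComponent_eq_zero _ _ (by simpa using h), map_zero]

/-! ### Leading exponents of elements of the Steinberg summand -/

/-- The substitution `x_i ↦ α`, `x_j ↦ β`, the other variables being kept. -/
def slice {n : ℕ} (i j : Fin n) (α β : Polynomial (ZMod 2)) :
    Poly n →ₐ[ZMod 2] MvPolynomial (Fin n) (Polynomial (ZMod 2)) :=
  aeval fun k => if k = i then C α else if k = j then C β else X k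

theorem coeff_slice {n : ℕ} {i j : Fin n} (hij : i ≠ j) (α β : Polynomial (ZMod 2)) (f : Poly n)
    (r : Fin n →₀ ℕ) :
    coeff r (slice i j α β f) = ∑ m ∈ f.support with (m.erase i).erase j = r,
      Polynomial.C (coeff m f) * (α ^ m i * β ^ m j) := by
  have hmon : ∀ m : Fin n →₀ ℕ, ∀ c : ZMod 2, slice i j α β (monomial m c) =
      monomial ((m.erase i).erase j) (Polynomial.C c * (α ^ m i * β ^ m j)) := by
    intro m c
    rw [slice, aeval_monomial, Finsupp.prod_fintype _ _ (fun _ => pow_zero _), monomial_eq,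
      Finsupp.prod_fintype _ _ (fun _ => pow_zero _), map_mul, mul_assoc]
    congr 1
    have : ∀ k, (if k = i then C α else if k = j then C β else X k :
        MvPolynomial (Fin n) (Polynomial (ZMod 2))) ^ m k =
        (if k = i then C (α ^ m i) else 1) * (if k = j then C (β ^ m j) else 1) *
          X k ^ ((m.erase i).erase j) k := by
      intro k
      rcases eq_or_ne k i with rfl | hki
      · simp [hij, Finsupp.erase_ne hij]
      · rcases eq_or_ne k j with rfl | hkj
        · simp [hki]
        · simp [hki, hkj]
    rw [Finset.prod_congr rfl fun k _ => this k, Finset.prod_mul_distrib, Finset.prod_mul_distrib,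
      Finset.prod_ite_eq', Finset.prod_ite_eq']
    simp
  conv_lhs => rw [f.as_sum]
  rw [map_sum, coeff_sum, Finset.sum_filter]
  refine Finset.sum_congr rfl fun m _ => ?_
  rw [hmon, coeff_monomial]

theorem slice_polyRep_transElt {n : ℕ} {i j : Fin n} (hij : i ≠ j) (f : Poly n) :
    slice i j 1 Polynomial.X (polyRep n (transElt i j hij) f) =
      map (Polynomial.aeval (Polynomial.X + 1 : Polynomial (ZMod 2))).toRingHom
        (slice i j 1 Polynomial.X f) := by
  have : (slice i j 1 Polynomial.X).comp (subst n (transElt i j hij).1) =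
      (mapAlgHom (Polynomial.aeval (Polynomial.X + 1 : Polynomial (ZMod 2)))).comp
        (slice i j 1 Polynomial.X) := by
    refine algHom_ext fun k => ?_
    have h := polyRep_transElt_X hij k
    rw [polyRep_apply] at h
    rw [AlgHom.comp_apply, h, AlgHom.comp_apply]
    by_cases hk : k = j
    · subst hk
      simp [slice, hij.symm, mapAlgHom_apply]
    · by_cases hki : k = i
      · subst hki
        simp [slice, hk, mapAlgHom_apply]
      · simp [slice, hk, hki, mapAlgHom_apply]
  exact DFunLike.congr_fun this f

theorem slice_polyRep_swap {n : ℕ} {i j : Fin n} (hij : i ≠ j) (f : Poly n) :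
    slice i j 1 Polynomial.X (polyRep n (permElt (Equiv.swap i j)) f) =
        slice i j Polynomial.X 1 f := by
  have : (slice i j 1 Polynomial.X).comp (subst n (permElt (Equiv.swap i j)).1) =
        slice i j Polynomial.X 1 := by
    refine algHom_ext fun k => ?_
    have h := polyRep_permElt_X (Equiv.swap i j) k
    rw [polyRep_apply] at h
    rw [AlgHom.comp_apply, h, Equiv.symm_swap, Equiv.swap_apply_def]
    simp only [slice, aeval_X]
    split_ifs <;> simp_all
  exact DFunLike.congr_fun this f

/-- A polynomial in one variable over `F_2` that is invariant under `y ↦ y + 1` and of the form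
`G(y) + G(y + 1)` has at least two roots of multiplicity `q` as soon as it is divisible by `y ^ q`,
and has degree less than that of `G`. -/
theorem two_mul_lt_natDegree {H G : Polynomial (ZMod 2)} {q : ℕ}
    (hH : H.comp (Polynomial.X + 1) = H) (hHG : H = G + G.comp (Polynomial.X + 1))
    (hq : Polynomial.X ^ q ∣ H) (h0 : H ≠ 0) : 2 * q < G.natDegree := by
  have hG0 : G ≠ 0 := by
    rintro rfl; simp at hHG; exact h0 hHG
  have hcomp : Polynomial.comp G (Polynomial.X + 1) ≠ 0 := by
    rw [← Polynomial.C_1]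
    exact (Polynomial.comp_X_add_C_ne_zero_iff).2 hG0
  have hnd : (G.comp (Polynomial.X + 1)).natDegree = G.natDegree := by
    rw [Polynomial.natDegree_comp, ← Polynomial.C_1, Polynomial.natDegree_X_add_C, mul_one]
  have hlt : H.degree < G.degree := by
    rw [hHG, ← CharTwo.sub_eq_add]
    refine Polynomial.degree_sub_lt_left ?_ hG0 ?_
    · rw [Polynomial.degree_eq_natDegree hG0, Polynomial.degree_eq_natDegree hcomp, hnd]
    · rw [Polynomial.leadingCoeff_comp]
      · rw [← Polynomial.C_1, Polynomial.leadingCoeff_X_add_C]; simp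
      · rw [← Polynomial.C_1, Polynomial.natDegree_X_add_C]; exact one_ne_zero
  have hlt' : H.natDegree < G.natDegree := Polynomial.natDegree_lt_natDegree h0 hlt
  have hq' : (Polynomial.X + 1 : Polynomial (ZMod 2)) ^ q ∣ H := by
    obtain ⟨K, hK⟩ := hq
    refine ⟨K.comp (Polynomial.X + 1), ?_⟩
    rw [← hH, hK]; simp
  have hcop : IsCoprime (Polynomial.X ^ q : Polynomial (ZMod 2)) ((Polynomial.X + 1) ^ q) := by
    refine IsCoprime.pow ⟨-1, 1, by ring⟩
  have := Polynomial.natDegree_le_of_dvd (hcop.mul_dvd hq hq') h0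
  rw [Polynomial.natDegree_mul (pow_ne_zero _ Polynomial.X_ne_zero)
    (pow_ne_zero _ (by rw [← Polynomial.C_1]; exact Polynomial.X_add_C_ne_zero 1)),
    Polynomial.natDegree_pow, Polynomial.natDegree_pow, Polynomial.natDegree_X,
    ← Polynomial.C_1, Polynomial.natDegree_X_add_C] at this
  omega

theorem degree_eq_of_mem_support {n d : ℕ} {f : Poly n} (hf : f.IsHomogeneous d)
    {m : Fin n →₀ ℕ} (hm : m ∈ f.support) : m.degree = d := by
  have := hf (mem_support_iff.1 hm)
  rwa [Finsupp.degree_eq_weight_one]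

/-- Among the exponents of a homogeneous polynomial that agree with the lexicographic leading
exponent outside two adjacent positions, the leading one has the largest entry at the first of
these positions, and is determined by it. -/
theorem exponent_of_erase_eq_lexDegree {n d : ℕ} {i j : Fin n} (hij : (i : ℕ) + 1 = j)
    (hne : i ≠ j) {f : Poly n} (hf : f.IsHomogeneous d) {M m : Fin n →₀ ℕ}
    (hM : M = MonomialOrder.lex.degree f) (hMs : M ∈ f.support) (hm : m ∈ f.support)
    (hmr : (m.erase i).erase j = (M.erase i).erase j) :
    m i + m j = M i + M j ∧ m i ≤ M i ∧ (m i = M i → m = M) := by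
  have hsplit : ∀ m : Fin n →₀ ℕ, m = (m.erase i).erase j + Finsupp.single i (m i) +
      Finsupp.single j (m j) := by
    intro m
    ext k
    rcases eq_or_ne k i with rfl | hki
    · simp [hne, Finsupp.erase_ne hne]
    · rcases eq_or_ne k j with rfl | hkj
      · simp [hki]
      · simp [hki, hkj]
  have hsum : m i + m j = M i + M j := by
    have h1 := degree_eq_of_mem_support hf hm
    have h2 := degree_eq_of_mem_support hf hMs
    rw [hsplit m, hmr] at h1
    rw [hsplit M] at h2
    simp only [map_add, Finsupp.degree_single] at h1 h2
    omega
  refine ⟨hsum, ?_, fun hmi => ?_⟩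
  · by_contra! hlt
    have h1 : m ≼[MonomialOrder.lex] M := hM ▸ MonomialOrder.le_degree hm
    refine absurd h1 (not_le.2 (MonomialOrder.lex_lt_iff.2 ?_))
    refine Finsupp.Lex.lt_iff.2 ⟨i, fun k hk => ?_, hlt⟩
    have h2 : ((m.erase i).erase j) k = ((M.erase i).erase j) k := by rw [hmr]
    have hk' : k < i := hk
    have hkj : k ≠ j := by rintro rfl; rw [Fin.lt_def] at hk'; omega
    rw [Finsupp.erase_ne hkj, Finsupp.erase_ne hk'.ne, Finsupp.erase_ne hkj,
      Finsupp.erase_ne hk'.ne] at h2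
    exact h2.symm
  · rw [hsplit m, hsplit M, hmr, hmi, show m j = M j by omega]

/-- The lexicographic leading exponent of a homogeneous polynomial that satisfies the relations of
the Steinberg summand for the variables `x_i` and `x_j`, where `j = i + 1`. Among the terms that
agree with the leading one outside `x_i` and `x_j`, setting `x_i = 1` and `x_j = y` leads to a
polynomial in `y` to which `two_mul_lt_natDegree` applies. -/
theorem two_mul_lexDegree_lt {n d : ℕ} {i j : Fin n} (hij : (i : ℕ) + 1 = j) (hne : i ≠ j)
    {f : Poly n} (hf : f.IsHomogeneous d) (h0 : f ≠ 0)
    (ht : polyRep n (transElt i j hne) f = f)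
    (h3 : f + polyRep n (permElt (Equiv.swap i j)) f +
      polyRep n (transElt i j hne) (polyRep n (permElt (Equiv.swap i j)) f) = 0) :
    2 * MonomialOrder.lex.degree f j < MonomialOrder.lex.degree f i := by
  have hMs : MonomialOrder.lex.degree f ∈ f.support := MonomialOrder.degree_mem_support h0
  obtain ⟨M, hM⟩ : ∃ M, M = MonomialOrder.lex.degree f := ⟨_, rfl⟩
  rw [← hM] at hMs ⊢
  obtain ⟨r, hr⟩ : ∃ r, r = (M.erase i).erase j := ⟨_, rfl⟩
  have hexp : ∀ m ∈ f.support.filter (fun m => (m.erase i).erase j = r),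
      m i + m j = M i + M j ∧ m i ≤ M i ∧ (m i = M i → m = M) := fun m hm =>
    exponent_of_erase_eq_lexDegree hij hne hf hM hMs (Finset.mem_filter.1 hm).1
      ((Finset.mem_filter.1 hm).2.trans hr)
  obtain ⟨H, hH⟩ : ∃ H, H = coeff r (slice i j 1 Polynomial.X f) := ⟨_, rfl⟩
  obtain ⟨G, hG⟩ : ∃ G, G = coeff r (slice i j Polynomial.X 1 f) := ⟨_, rfl⟩
  have hHcomp : H.comp (Polynomial.X + 1) = H := by
    have := congrArg (fun p => coeff r (slice i j 1 Polynomial.X p)) ht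
    simp only [slice_polyRep_transElt, coeff_map] at this
    rw [hH]
    exact this
  have hHG : H = G + G.comp (Polynomial.X + 1) := by
    have := congrArg (fun p => coeff r (slice i j 1 Polynomial.X p)) h3
    simp only [map_add, slice_polyRep_transElt, slice_polyRep_swap hne, coeff_add, coeff_map,
      map_zero, coeff_zero] at this
    rw [add_assoc, ← hH, ← hG] at this
    exact CharTwo.add_eq_zero.1 this
  have hHs : H = ∑ m ∈ f.support with (m.erase i).erase j = r,
      Polynomial.C (coeff m f) * Polynomial.X ^ m j := by
    rw [hH, coeff_slice hne]; simp only [one_pow, one_mul]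
  have hGs : G = ∑ m ∈ f.support with (m.erase i).erase j = r,
      Polynomial.C (coeff m f) * Polynomial.X ^ m i := by
    rw [hG, coeff_slice hne]; simp only [one_pow, mul_one]
  have hq : Polynomial.X ^ M j ∣ H := by
    rw [hHs]
    refine Finset.dvd_sum fun m hm => Dvd.dvd.mul_left (pow_dvd_pow _ ?_) _
    have := hexp m hm
    omega
  have hH0 : H ≠ 0 := by
    intro h
    have hc : H.coeff (M j) = coeff M f := by
      rw [hHs, Polynomial.finsetSum_coeff, Finset.sum_eq_single M]
      · rw [Polynomial.coeff_C_mul_X_pow, if_pos rfl]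
      · intro m hm hmM
        rw [Polynomial.coeff_C_mul_X_pow, if_neg]
        intro hmj
        have := hexp m hm
        exact hmM (this.2.2 (by omega))
      · intro hnot
        exact absurd (Finset.mem_filter.2 ⟨hMs, hr.symm⟩) hnot
    rw [h, Polynomial.coeff_zero] at hc
    exact mem_support_iff.1 hMs hc.symm
  refine (two_mul_lt_natDegree hHcomp hHG hq hH0).trans_le ?_
  rw [hGs]
  refine Polynomial.natDegree_sum_le_of_forall_le _ _ fun m hm => ?_
  exact (Polynomial.natDegree_C_mul_X_pow_le _ _).trans (hexp m hm).2.1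

/-! ### Linear forms and the polynomials `ω_k` -/

/-- The linear form with coefficient vector `v`. -/
def linForm {n : ℕ} (v : Fin n → ZMod 2) : Poly n := ∑ j : Fin n, C (v j) * X j

theorem linForm_add {n : ℕ} (v w : Fin n → ZMod 2) : linForm (v + w) = linForm v + linForm w := by
  simp [linForm, add_mul, Finset.sum_add_distrib]

theorem linForm_single {n : ℕ} (k : Fin n) : linForm (Pi.single k 1) = X k := by
  rw [linForm, Finset.sum_eq_single k]
  · simp
  · intro j _ hj; simp [hj]
  · simp

theorem polyRep_linForm {n : ℕ} (g : GLn n) (v : Fin n → ZMod 2) :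
    polyRep n g (linForm v) = linForm (g.1 *ᵥ v) := by
  simp only [linForm, map_sum, polyRep_apply, map_mul, subst, aeval_X, algHom_C, algebraMap_eq,
    mulVec, dotProduct, Finset.mul_sum, Finset.sum_mul]
  rw [Finset.sum_comm]
  refine Finset.sum_congr rfl fun j _ => Finset.sum_congr rfl fun i _ => ?_
  ring

/-- The coefficient vectors of the linear forms in the first `k` variables. -/
def flagStep (n k : ℕ) : Finset (Fin n → ZMod 2) :=
  Finset.univ.filter fun v => ∀ j : Fin n, k ≤ (j : ℕ) → v j = 0

theorem mem_flagStep {n k : ℕ} {v : Fin n → ZMod 2} :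
    v ∈ flagStep n k ↔ ∀ j : Fin n, k ≤ (j : ℕ) → v j = 0 := by
  simp [flagStep]

theorem omega_eq {n k : ℕ} : omega n k = ∏ v ∈ flagStep n k, if v = 0 then 1 else linForm v := by
  rw [Finset.prod_ite, Finset.prod_const_one, one_mul]
  refine Finset.prod_congr ?_ fun _ _ => rfl
  ext v
  simp [flagStep, and_comm]

theorem prod_flagStep_succ {n : ℕ} (k : Fin n) {A : Type*} [CommMonoid A]
    (F : (Fin n → ZMod 2) → A) :
    ∏ v ∈ flagStep n (k + 1), F v =
      (∏ v ∈ flagStep n k, F v) * ∏ v ∈ flagStep n k, F (v + Pi.single k 1) := by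
  rw [← Finset.prod_filter_mul_prod_filter_not _ (fun v => v k = 0)]
  congr 1
  · refine Finset.prod_congr ?_ fun _ _ => rfl
    ext v
    simp only [Finset.mem_filter, mem_flagStep]
    constructor
    · rintro ⟨h, h0⟩ j hj
      rcases eq_or_ne j k with rfl | hjk
      · exact h0
      · refine h j ?_
        have : (j : ℕ) ≠ k := fun h => hjk (Fin.ext h)
        omega
    · exact fun h => ⟨fun j hj => h j (by omega), h k le_rfl⟩
  · symm
    refine Finset.prod_bij (fun v _ => v + Pi.single k 1) ?_ ?_ ?_ ?_
    · intro v hv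
      rw [mem_flagStep] at hv
      simp only [Finset.mem_filter, mem_flagStep]
      refine ⟨fun j hj => ?_, ?_⟩
      · have hjk : j ≠ k := by rintro rfl; omega
        simp [hv j (by omega), hjk]
      · simp [hv k le_rfl]
    · intro v _ w _ h
      exact add_right_cancel h
    · intro v hv
      simp only [Finset.mem_filter, mem_flagStep] at hv
      refine ⟨v + Pi.single k 1, ?_, by rw [add_assoc, ZModModule.add_self, add_zero]⟩
      rw [mem_flagStep]
      intro j hj
      rcases eq_or_ne j k with rfl | hjk
      · rw [Pi.add_apply, zmod_two_eq_one hv.2, Pi.single_eq_same]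
        exact CharTwo.add_self_eq_zero _
      · have : (j : ℕ) ≠ k := fun h => hjk (Fin.ext h)
        simp [hv.1 j (by omega), hjk]
    · intros; rfl

theorem flagStep_zero (n : ℕ) : flagStep n 0 = {0} := by
  ext v
  simp only [mem_flagStep, Finset.mem_singleton]
  exact ⟨fun h => funext fun j => h j (Nat.zero_le _), fun h j _ => by rw [h]; rfl⟩

theorem card_flagStep {n k : ℕ} (hk : k ≤ n) : (flagStep n k).card = 2 ^ k := by
  induction k with
  | zero => simp [flagStep_zero]
  | succ k ih =>
    have h := prod_flagStep_succ (⟨k, hk⟩ : Fin n) (fun _ => (2 : ℕ))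
    simp only [Finset.prod_const] at h
    rw [ih (by omega), ← pow_add] at h
    rw [Nat.pow_right_injective le_rfl h, pow_succ]
    ring

theorem mulVec_injective {n : ℕ} (g : GLn n) : Function.Injective (fun v => g.1 *ᵥ v) :=
  Matrix.mulVec_injective_of_isUnit g.isUnit

theorem image_flagStep {n k : ℕ} {g : GLn n}
    (hg : ∀ l m : Fin n, (m : ℕ) < k → k ≤ (l : ℕ) → g.1 l m = 0) :
    (flagStep n k).image (fun v => g.1 *ᵥ v) = flagStep n k := by
  refine Finset.eq_of_subset_of_card_le ?_ ?_
  · intro w hw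
    obtain ⟨v, hv, rfl⟩ := Finset.mem_image.1 hw
    rw [mem_flagStep] at hv ⊢
    intro l hl
    change ∑ m, g.1 l m * v m = 0
    refine Finset.sum_eq_zero fun m _ => ?_
    rcases lt_or_ge (m : ℕ) k with hm | hm
    · rw [hg l m hm hl, zero_mul]
    · rw [hv m hm, mul_zero]
  · rw [Finset.card_image_of_injective _ (mulVec_injective g)]

theorem mulVec_eq_zero_iff {n : ℕ} (g : GLn n) (v : Fin n → ZMod 2) : g.1 *ᵥ v = 0 ↔ v = 0 := by
  refine ⟨fun h => mulVec_injective g ?_, fun h => by rw [h, mulVec_zero]⟩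
  simpa using h

theorem polyRep_prod {n : ℕ} {ι : Type*} (s : Finset ι) (g : GLn n) (F : ι → Poly n) :
    polyRep n g (∏ i ∈ s, F i) = ∏ i ∈ s, polyRep n g (F i) := by
  simp only [polyRep_apply, map_prod]

theorem polyRep_pow {n : ℕ} (g : GLn n) (p : Poly n) (e : ℕ) :
    polyRep n g (p ^ e) = polyRep n g p ^ e := by
  simp only [polyRep_apply, map_pow]

theorem polyRep_omega_eq_prod {n k : ℕ} (g : GLn n) : polyRep n g (omega n k) =
    ∏ v ∈ flagStep n k, if v = 0 then 1 else linForm (g.1 *ᵥ v) := by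
  rw [omega_eq, polyRep_prod]
  refine Finset.prod_congr rfl fun v _ => ?_
  split_ifs
  · rw [polyRep_apply, map_one]
  · rw [polyRep_linForm]

theorem polyRep_omega_of_stable {n k : ℕ} {g : GLn n}
    (hg : ∀ l m : Fin n, (m : ℕ) < k → k ≤ (l : ℕ) → g.1 l m = 0) :
    polyRep n g (omega n k) = omega n k := by
  rw [polyRep_omega_eq_prod, omega_eq]
  conv_rhs => rw [← image_flagStep hg]
  rw [Finset.prod_image fun v _ w _ h => mulVec_injective g h]
  simp only [mulVec_eq_zero_iff]

theorem polyRep_omega_of_mem_borel {n k : ℕ} {g : GLn n} (hg : g ∈ borel n) :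
    polyRep n g (omega n k) = omega n k :=
  polyRep_omega_of_stable fun l m hm hl => hg l m (by rw [Fin.lt_def]; omega)

theorem permElt_swap_stable {n k : ℕ} {i j : Fin n} (hij : (i : ℕ) + 1 = j) (hk : k ≠ (i : ℕ) + 1)
    (l m : Fin n) (hm : (m : ℕ) < k) (hl : k ≤ (l : ℕ)) :
    (permElt (Equiv.swap i j)).1 l m = 0 := by
  rw [permElt_apply, if_neg]
  rw [Equiv.swap_apply_def]
  split_ifs <;> rintro rfl <;> simp only [Fin.ext_iff] at * <;> omega

/-- The product of the translates of `y` by the linear forms in the first `k` variables; as a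
function of `y` it is an additive polynomial. -/
def flagPoly {n : ℕ} (k : ℕ) (y : Poly n) : Poly n := ∏ v ∈ flagStep n k, (y + linForm v)

theorem flagPoly_succ {n : ℕ} (k : Fin n) (y : Poly n) :
    flagPoly (k + 1) y = flagPoly k y * flagPoly k (y + X k) := by
  rw [flagPoly, prod_flagStep_succ]
  congr 1
  refine Finset.prod_congr rfl fun v _ => ?_
  rw [linForm_add, linForm_single]
  ring

theorem flagPoly_add {n k : ℕ} (hk : k ≤ n) (y z : Poly n) :
    flagPoly k (y + z) = flagPoly k y + flagPoly k z := by
  induction k generalizing y z with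
  | zero => simp [flagPoly, flagStep_zero, linForm]
  | succ k ih =>
    have hs := fun y => flagPoly_succ (⟨k, hk⟩ : Fin n) y
    simp only at hs
    have ih' := fun y z => ih (by omega) y z
    simp only [hs, ih']
    have : (2 : Poly n) = 0 := CharTwo.two_eq_zero
    linear_combination (flagPoly k y * flagPoly k z) * this

theorem omega_succ {n : ℕ} (k : Fin n) : omega n (k + 1) = omega n k * flagPoly k (X k) := by
  rw [omega_eq, prod_flagStep_succ, ← omega_eq]
  congr 1
  refine Finset.prod_congr rfl fun v hv => ?_
  rw [if_neg, linForm_add, linForm_single, add_comm]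
  intro h
  have := congrFun h k
  rw [Pi.add_apply, mem_flagStep.1 hv k le_rfl] at this
  simp at this

theorem polyRep_flagPoly {n k : ℕ} {g : GLn n}
    (hg : ∀ l m : Fin n, (m : ℕ) < k → k ≤ (l : ℕ) → g.1 l m = 0) (y : Poly n) :
    polyRep n g (flagPoly k y) = flagPoly k (polyRep n g y) := by
  rw [flagPoly, polyRep_prod, flagPoly]
  conv_rhs => rw [← image_flagStep hg]
  rw [Finset.prod_image fun v _ w _ h => mulVec_injective g h]
  refine Finset.prod_congr rfl fun v _ => ?_
  rw [map_add, polyRep_linForm]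

/-- The standard flag step spanned by `x_0, …, x_i` and its translates under `s` and `t s` are the
three subspaces between two steps of the standard flag whose dimensions differ by two. Their
products of nonzero linear forms add up to zero: they are `omega n i` times the values of an
additive polynomial at the three nonzero elements `x_i`, `x_j`, `x_i + x_j` of a plane. -/
theorem omega_parabolic_sum {n : ℕ} {i j : Fin n} (hij : (i : ℕ) + 1 = j) (hne : i ≠ j) :
    omega n (i + 1) + polyRep n (permElt (Equiv.swap i j)) (omega n (i + 1)) +
      polyRep n (transElt i j hne) (polyRep n (permElt (Equiv.swap i j)) (omega n (i + 1))) =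
      0 := by
  have hs := permElt_swap_stable (k := i) hij (by omega)
  have hlt : i < j := by rw [Fin.lt_def]; omega
  have ht : ∀ l m : Fin n, (m : ℕ) < (i : ℕ) → (i : ℕ) ≤ (l : ℕ) → (transElt i j hne).1 l m = 0 :=
    fun l m hm hl => transElt_mem_borel hlt l m (by rw [Fin.lt_def]; omega)
  rw [omega_succ, polyRep_mul, polyRep_mul, polyRep_omega_of_stable hs, polyRep_omega_of_stable ht,
    polyRep_flagPoly hs, polyRep_flagPoly ht, polyRep_permElt_X, Equiv.symm_swap,
    Equiv.swap_apply_left, polyRep_transElt_X, if_pos rfl, flagPoly_add i.2.le]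
  have : (2 : Poly n) = 0 := CharTwo.two_eq_zero
  linear_combination (omega n i * (flagPoly i (X i) + flagPoly i (X j))) * this

/-! ### Leading exponents of the translates of `ω_k` -/

theorem coeff_linForm {n : ℕ} (v : Fin n → ZMod 2) (l : Fin n) :
    coeff (Finsupp.single l 1) (linForm v) = v l := by
  rw [linForm, coeff_sum, Finset.sum_eq_single l]
  · simp
  · intro j _ hj
    rw [coeff_C_mul, coeff_X, if_neg, mul_zero]
    intro h
    exact hj (Finsupp.single_left_injective one_ne_zero h)
  · simp

theorem linForm_ne_zero {n : ℕ} {v : Fin n → ZMod 2} (hv : v ≠ 0) : linForm v ≠ 0 := by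
  intro h
  apply hv
  ext l
  rw [← coeff_linForm v l, h]
  simp

theorem linForm_isHomogeneous {n : ℕ} (v : Fin n → ZMod 2) : (linForm v).IsHomogeneous 1 := by
  refine IsHomogeneous.sum _ _ _ fun j _ => ?_
  rw [← zero_add 1]
  exact (isHomogeneous_C _ _).mul (isHomogeneous_X _ _)

theorem lexDegree_linForm {n : ℕ} {v : Fin n → ZMod 2} {l : Fin n} (hl : v l ≠ 0)
    (hlt : ∀ m < l, v m = 0) :
    MonomialOrder.lex.degree (linForm v) = Finsupp.single l 1 := by
  apply MonomialOrder.lex.toSyn.injective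
  refine le_antisymm (MonomialOrder.degree_le_iff.2 fun c hc => ?_) (MonomialOrder.le_degree ?_)
  · rw [mem_support_iff] at hc
    obtain ⟨m, rfl⟩ : ∃ m, c = Finsupp.single m 1 := by
      rw [linForm, coeff_sum] at hc
      obtain ⟨m, -, hm⟩ := Finset.exists_ne_zero_of_sum_ne_zero hc
      rw [coeff_C_mul, coeff_X] at hm
      refine ⟨m, ?_⟩
      by_contra h
      rw [if_neg (Ne.symm h), mul_zero] at hm
      exact hm rfl
    rw [coeff_linForm] at hc
    rcases lt_trichotomy m l with h | rfl | h
    · exact absurd (hlt m h) hc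
    · exact le_rfl
    · refine (MonomialOrder.lex_lt_iff.2 (Finsupp.Lex.lt_iff.2 ⟨l, fun k hk => ?_, ?_⟩)).le
      · have hk' : k < l := hk
        simp [hk'.ne, (hk'.trans h).ne]
      · simp [h.ne]
  · rw [mem_support_iff, coeff_linForm]
    exact hl

theorem lexDegree_linForm_apply {n : ℕ} {v : Fin n → ZMod 2} (hv : v ≠ 0) (l : Fin n) :
    MonomialOrder.lex.degree (linForm v) l = if v l ≠ 0 ∧ ∀ m < l, v m = 0 then 1 else 0 := by
  obtain ⟨l₀, h1, h2⟩ : ∃ l, v l ≠ 0 ∧ ∀ m < l, v m = 0 := by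
    have hex : ∃ l, v l ≠ 0 := Function.ne_iff.1 hv
    obtain ⟨l, hl⟩ := exists_minimal_of_wellFoundedLT (fun l => v l ≠ 0) hex
    refine ⟨l, hl.1, fun m hm => ?_⟩
    by_contra h
    exact absurd (hl.2 h hm.le) hm.not_ge
  rw [lexDegree_linForm h1 h2]
  rcases lt_trichotomy l l₀ with h | rfl | h
  · rw [if_neg (fun hc => hc.1 (h2 l h)), Finsupp.single_eq_of_ne h.ne]
  · rw [if_pos ⟨h1, h2⟩, Finsupp.single_eq_same]
  · rw [if_neg (fun hc => h1 (hc.2 l₀ h)), Finsupp.single_eq_of_ne h.ne']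

/-- The number of vectors `v` in the `k`-th step of the flag such that `g v` has its first nonzero
entry at position `l`. -/
def pivotCount {n : ℕ} (k : ℕ) (g : GLn n) (l : Fin n) : ℕ :=
  ((flagStep n k).filter fun v => (g.1 *ᵥ v) l ≠ 0 ∧ ∀ m < l, (g.1 *ᵥ v) m = 0).card

/-- The number of vectors `v` in the `k`-th step of the flag such that the first `l` entries of
`g v` are zero. -/
def tailCount {n : ℕ} (k : ℕ) (g : GLn n) (l : ℕ) : ℕ :=
  ((flagStep n k).filter fun v => ∀ m : Fin n, (m : ℕ) < l → (g.1 *ᵥ v) m = 0).card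

theorem lexDegree_polyRep_omega {n k : ℕ} (g : GLn n) (l : Fin n) :
    MonomialOrder.lex.degree (polyRep n g (omega n k)) l = pivotCount k g l := by
  rw [polyRep_omega_eq_prod, MonomialOrder.degree_prod, Finsupp.finsetSum_apply, pivotCount,
    Finset.card_filter]
  · refine Finset.sum_congr rfl fun v _ => ?_
    by_cases hv : v = 0
    · rw [if_pos hv, MonomialOrder.degree_one, hv, if_neg]
      · rfl
      · simp
    · rw [if_neg hv, lexDegree_linForm_apply (mt (mulVec_eq_zero_iff g v).1 hv)]
  · intro v _
    split_ifs with hv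
    · exact one_ne_zero
    · exact linForm_ne_zero (mt (mulVec_eq_zero_iff g v).1 hv)

theorem polyRep_omega_ne_zero {n k : ℕ} (g : GLn n) : polyRep n g (omega n k) ≠ 0 := by
  rw [polyRep_omega_eq_prod, Finset.prod_ne_zero_iff]
  intro v _
  split_ifs with hv
  · exact one_ne_zero
  · exact linForm_ne_zero (mt (mulVec_eq_zero_iff g v).1 hv)

theorem tailCount_zero {n k : ℕ} (hk : k ≤ n) (g : GLn n) : tailCount k g 0 = 2 ^ k := by
  rw [tailCount, ← card_flagStep hk]
  simp

theorem pivotCount_add_tailCount {n k : ℕ} (g : GLn n) (l : Fin n) :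
    pivotCount k g l + tailCount k g (l + 1) = tailCount k g l := by
  rw [tailCount, tailCount, pivotCount, ← Finset.card_union_of_disjoint]
  · congr 1
    ext v
    simp only [Finset.mem_union, Finset.mem_filter]
    constructor
    · rintro (⟨hv, -, h⟩ | ⟨hv, h⟩)
      · exact ⟨hv, fun m hm => h m hm⟩
      · exact ⟨hv, fun m hm => h m (by omega)⟩
    · rintro ⟨hv, h⟩
      by_cases h0 : (g.1 *ᵥ v) l = 0
      · refine Or.inr ⟨hv, fun m hm => ?_⟩
        rcases eq_or_ne m l with rfl | hml
        · exact h0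
        · have : (m : ℕ) ≠ l := fun h => hml (Fin.ext h)
          exact h m (by omega)
      · exact Or.inl ⟨hv, h0, fun m hm => h m hm⟩
  · rw [Finset.disjoint_left]
    intro v h1 h2
    exact (Finset.mem_filter.1 h1).2.1 ((Finset.mem_filter.1 h2).2 l (by omega))

/-- Translation by one vector with pivot at `l` moves all such vectors to vectors whose pivot is
beyond `l`. -/
theorem pivotCount_le_tailCount {n k : ℕ} (g : GLn n) (l : Fin n) :
    pivotCount k g l ≤ tailCount k g (l + 1) := by
  rw [pivotCount, tailCount]
  rcases Finset.eq_empty_or_nonempty ((flagStep n k).filter fun v =>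
    (g.1 *ᵥ v) l ≠ 0 ∧ ∀ m < l, (g.1 *ᵥ v) m = 0) with h | ⟨w, hw⟩
  · rw [h]; simp
  · refine Finset.card_le_card_of_injOn (fun v => v + w) ?_ fun _ _ _ _ h => add_right_cancel h
    intro v hv
    simp only [Finset.coe_filter, Set.mem_ofPred_eq, Finset.mem_filter, mem_flagStep] at hv hw ⊢
    refine ⟨fun j hj => by rw [Pi.add_apply, hv.1 j hj, hw.1 j hj, add_zero], fun m hm => ?_⟩
    rw [mulVec_add, Pi.add_apply]
    rcases eq_or_ne m l with rfl | hml
    · rw [zmod_two_eq_one hv.2.1, zmod_two_eq_one hw.2.1]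
      exact CharTwo.add_self_eq_zero _
    · have : (m : ℕ) ≠ l := fun h => hml (Fin.ext h)
      have hm' : m < l := by rw [Fin.lt_def]; omega
      rw [hv.2.2 m hm', hw.2.2 m hm', add_zero]

/-- The lexicographic leading exponent `(2 ^ (k - 1), …, 2, 1, 0, …, 0)` of `ω_k`. -/
def omegaDegree (n k : ℕ) : Fin n →₀ ℕ :=
  Finsupp.equivFunOnFinite.symm fun l => if (l : ℕ) < k then 2 ^ (k - 1 - l) else 0

theorem omegaDegree_apply {n k : ℕ} (l : Fin n) :
    omegaDegree n k l = if (l : ℕ) < k then 2 ^ (k - 1 - l) else 0 := rfl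

/-- The pivots of the vectors of a `k`-dimensional subspace are lexicographically as early as
possible when the subspace projects isomorphically onto the first `k` coordinates. -/
theorem lexDegree_polyRep_omega_le {n k : ℕ} (hk : k ≤ n) (g : GLn n) :
    MonomialOrder.lex.degree (polyRep n g (omega n k)) ≼[MonomialOrder.lex] omegaDegree n k := by
  by_contra! hlt
  obtain ⟨l, heq, hl⟩ := Finsupp.Lex.lt_iff.1 (MonomialOrder.lex_lt_iff.1 hlt)
  have heq' : ∀ m : Fin n, m < l → omegaDegree n k m = pivotCount k g m := fun m hm =>
    (heq m hm).trans (lexDegree_polyRep_omega g m)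
  have hl' : omegaDegree n k l < pivotCount k g l := by
    rw [← lexDegree_polyRep_omega]; exact hl
  have htail : ∀ p : ℕ, p ≤ (l : ℕ) → tailCount k g p = 2 ^ (k - p) := by
    intro p hp
    induction p with
    | zero => rw [tailCount_zero hk, Nat.sub_zero]
    | succ p ih =>
      have h1 := pivotCount_add_tailCount (k := k) g ⟨p, by omega⟩
      rw [← heq' ⟨p, by omega⟩ (by rw [Fin.lt_def]; exact hp), omegaDegree_apply] at h1
      simp only [ih (by omega)] at h1
      split_ifs at h1 with hpk
      · rw [show k - p = (k - 1 - p) + 1 by omega, pow_succ] at h1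
        rw [show k - (p + 1) = k - 1 - p by omega]
        omega
      · rw [show k - p = 0 by omega] at h1
        rw [show k - (p + 1) = 0 by omega]
        omega
  have h1 := pivotCount_add_tailCount (k := k) g l
  have h2 := pivotCount_le_tailCount (k := k) g l
  rw [htail l le_rfl] at h1
  rw [omegaDegree_apply] at hl'
  split_ifs at hl' with hlk
  · rw [show k - (l : ℕ) = (k - 1 - l) + 1 by omega, pow_succ] at h1
    omega
  · rw [show k - (l : ℕ) = 0 by omega] at h1
    omega

theorem tailCount_one_flag {n k : ℕ} (hk : k ≤ n) {l : ℕ} (hl : l ≤ k) :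
    tailCount k (1 : GLn n) l = 2 ^ (k - l) := by
  have hstep : ∀ p, p < k → tailCount k (1 : GLn n) p ≤ 2 * tailCount k (1 : GLn n) (p + 1) := by
    intro p hp
    have h1 := pivotCount_add_tailCount (k := k) (1 : GLn n) ⟨p, by omega⟩
    have h2 := pivotCount_le_tailCount (k := k) (1 : GLn n) ⟨p, by omega⟩
    simp only at h1 h2
    omega
  apply le_antisymm
  · -- descending from the `k`-th count, which only sees the zero vector
    induction hd : k - l generalizing l with
    | zero =>
      rw [show l = k by omega, tailCount, pow_zero, Finset.card_le_one]
      intro v hv w hw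
      simp only [Finset.mem_filter, mem_flagStep, Units.val_one, one_mulVec] at hv hw
      ext m
      rcases lt_or_ge (m : ℕ) k with hm | hm
      · rw [hv.2 m hm, hw.2 m hm]
      · rw [hv.1 m hm, hw.1 m hm]
    | succ d ih =>
      have h1 := ih (l := l + 1) (by omega) (by omega)
      have h2 := hstep l (by omega)
      rw [pow_succ]
      omega
  · -- ascending from the full count
    induction l with
    | zero => rw [tailCount_zero hk, Nat.sub_zero]
    | succ l ih =>
      have h1 := ih (by omega)
      have h2 := hstep l (by omega)
      rw [show k - l = k - (l + 1) + 1 by omega, pow_succ] at h1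
      omega

theorem lexDegree_omega {n k : ℕ} (hk : k ≤ n) :
    MonomialOrder.lex.degree (omega n k) = omegaDegree n k := by
  ext l
  have h := lexDegree_polyRep_omega (k := k) (1 : GLn n) l
  rw [map_one, Module.End.one_apply] at h
  rw [h, omegaDegree_apply]
  split_ifs with hl
  · have h1 := pivotCount_add_tailCount (k := k) (1 : GLn n) l
    rw [tailCount_one_flag hk hl.le, tailCount_one_flag hk hl,
      show k - (l : ℕ) = (k - 1 - l) + 1 by omega, pow_succ,
      show k - ((l : ℕ) + 1) = k - 1 - l by omega] at h1
    omega
  · rw [pivotCount, Finset.card_eq_zero, Finset.filter_eq_empty_iff]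
    intro v hv h
    rw [Units.val_one, one_mulVec, mem_flagStep.1 hv l (by omega)] at h
    exact h.1 rfl

theorem omega_ne_zero {n k : ℕ} : omega n k ≠ 0 := by
  have := polyRep_omega_ne_zero (k := k) (1 : GLn n)
  rwa [map_one, Module.End.one_apply] at this

theorem exists_omega_isHomogeneous (n k : ℕ) : ∃ d, (omega n k).IsHomogeneous d :=
  ⟨_, IsHomogeneous.prod _ _ (fun _ => 1) fun v _ => linForm_isHomogeneous v⟩

/-! ### Leading exponents of the elements `e_n · ω^I` -/

/-- An admissible sequence as an exponent vector. -/
def Admissible.exponent {n : ℕ} (I : Admissible n) : Fin n →₀ ℕ :=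
  Finsupp.equivFunOnFinite.symm I.1

theorem Admissible.exponent_apply {n : ℕ} (I : Admissible n) (k : Fin n) :
    I.exponent k = I.1 k := rfl

theorem Admissible.exponent_injective {n : ℕ} :
    Function.Injective (Admissible.exponent (n := n)) := fun _ _ h =>
  Subtype.ext (Finsupp.equivFunOnFinite.symm.injective h)

theorem Admissible.degree_exponent {n : ℕ} (I : Admissible n) : I.exponent.degree = I.degree := by
  rw [Finsupp.degree_eq_sum]
  rfl

theorem Admissible.two_mul_lt {n : ℕ} (I : Admissible n) {i j : Fin n} (hij : (i : ℕ) + 1 = j) :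
    2 * I.1 j < I.1 i := by
  have h := I.2 i j (by rw [Fin.lt_def]; omega)
  rw [← hij, pow_succ, mul_assoc] at h
  exact lt_of_mul_lt_mul_left h (Nat.zero_le _)

theorem exists_admissible_exponent_eq {n : ℕ} {M : Fin n →₀ ℕ}
    (hM : ∀ i j : Fin n, (i : ℕ) + 1 = j → 2 * M j < M i) :
    ∃ I : Admissible n, I.exponent = M := by
  have hanti : StrictAnti fun k : Fin n => 2 ^ (k : ℕ) * M k := by
    cases n with
    | zero => intro a; exact a.elim0
    | succ m =>
      rw [Fin.strictAnti_iff_succ_lt]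
      intro i
      have := hM i.castSucc i.succ (by simp)
      rw [Fin.val_succ, Fin.val_castSucc, pow_succ, mul_assoc]
      exact Nat.mul_lt_mul_of_pos_left this (by positivity)
  exact ⟨⟨M, fun j k hjk => hanti hjk⟩, Finsupp.ext fun _ => rfl⟩

theorem omegaExp_pos {n : ℕ} (I : Admissible n) {i j : Fin n} (hij : (i : ℕ) + 1 = j) :
    omegaExp I i ≠ 0 := by
  have h := I.two_mul_lt hij
  have hlt : (i : ℕ) + 1 < n := by omega
  rw [omegaExp, dif_pos hlt, show (⟨(i : ℕ) + 1, hlt⟩ : Fin n) = j from Fin.ext hij]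
  omega

theorem sum_omegaExp_smul {n : ℕ} (I : Admissible n) :
    ∑ k : Fin n, omegaExp I k • omegaDegree n ((k : ℕ) + 1) = I.exponent := by
  ext l
  rw [Finsupp.finsetSum_apply]
  simp only [Finsupp.smul_apply, smul_eq_mul, omegaDegree_apply, I.exponent_apply]
  induction hd : n - (l : ℕ) generalizing l with
  | zero => omega
  | succ d ih =>
    by_cases hl : (l : ℕ) + 1 < n
    · have h1 := ih ⟨(l : ℕ) + 1, hl⟩ (by simp only; omega)
      have h2 := I.two_mul_lt (i := l) (j := ⟨(l : ℕ) + 1, hl⟩) rfl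
      have h3 : I.1 l = omegaExp I l + 2 * I.1 ⟨(l : ℕ) + 1, hl⟩ := by
        rw [omegaExp, dif_pos hl]; omega
      rw [h3, ← h1, Finset.mul_sum]
      have h4 : omegaExp I l = ∑ k : Fin n, if k = l then omegaExp I k else 0 := by simp
      rw [h4, ← Finset.sum_add_distrib]
      refine Finset.sum_congr rfl fun k _ => ?_
      rcases lt_trichotomy k l with h | rfl | h
      · rw [Fin.lt_def] at h
        rw [if_neg (by omega), if_neg (by rintro rfl; omega), if_neg (by simp only; omega)]
        simp
      · simp
      · rw [if_neg h.ne']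
        rw [Fin.lt_def] at h
        rw [if_pos (by omega), if_pos (by simp only; omega)]
        simp only [Nat.add_sub_cancel]
        rw [show (k : ℕ) - l = ((k : ℕ) - (l + 1)) + 1 by omega, pow_succ]
        ring
    · rw [Finset.sum_eq_single l]
      · rw [if_pos (by omega), omegaExp, dif_neg hl]; simp
      · intro k _ hk
        have : (k : ℕ) ≠ l := fun h => hk (Fin.ext h)
        rw [if_neg (by omega), mul_zero]
      · simp

theorem lexDegree_omegaMonomial {n : ℕ} (I : Admissible n) :
    MonomialOrder.lex.degree (omegaMonomial I) = I.exponent := by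
  rw [omegaMonomial, MonomialOrder.degree_prod fun k _ => pow_ne_zero _ omega_ne_zero,
    ← sum_omegaExp_smul]
  refine Finset.sum_congr rfl fun k _ => ?_
  rw [MonomialOrder.degree_pow, lexDegree_omega (Nat.succ_le_of_lt k.2)]

theorem coeff_exponent_omegaMonomial {n : ℕ} (I : Admissible n) :
    coeff I.exponent (omegaMonomial I) = 1 := by
  rw [← lexDegree_omegaMonomial]
  refine zmod_two_eq_one (MonomialOrder.coeff_degree_ne_zero_iff.2 ?_)
  exact Finset.prod_ne_zero_iff.2 fun k _ => pow_ne_zero _ omega_ne_zero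

theorem omegaMonomial_isHomogeneous {n : ℕ} (I : Admissible n) :
    (omegaMonomial I).IsHomogeneous I.degree := by
  choose e he using fun k => exists_omega_isHomogeneous n k
  have h : (omegaMonomial I).IsHomogeneous (∑ k : Fin n, e ((k : ℕ) + 1) * omegaExp I k) :=
    IsHomogeneous.prod _ _ _ fun k _ => (he _).pow _
  have hmem : I.exponent ∈ (omegaMonomial I).support := by
    rw [mem_support_iff, coeff_exponent_omegaMonomial]; exact one_ne_zero
  rwa [← degree_eq_of_mem_support h hmem, I.degree_exponent] at h

theorem coeff_nsmul_pow {n : ℕ} {p : Poly n} {δ : Fin n →₀ ℕ}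
    (hp : MonomialOrder.lex.degree p ≼[MonomialOrder.lex] δ) (e : ℕ) :
    coeff (e • δ) (p ^ e) = coeff δ p ^ e := by
  induction e with
  | zero => simp
  | succ e ih =>
    rw [pow_succ, succ_nsmul, MonomialOrder.coeff_mul_of_add_of_degree_le _ hp, ih, pow_succ]
    refine (MonomialOrder.degree_pow_le e).trans ?_
    rw [map_nsmul, map_nsmul]
    exact nsmul_le_nsmul_right hp e

/-- Over `F_2`, taking positive powers does not change leading coefficients. Therefore the top
coefficient of the sum of the powers is that of `p + q + r = 0`. -/
theorem coeff_sum_pow_eq_zero {n : ℕ} {p q r : Poly n} {δ : Fin n →₀ ℕ}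
    (hp : MonomialOrder.lex.degree p ≼[MonomialOrder.lex] δ)
    (hq : MonomialOrder.lex.degree q ≼[MonomialOrder.lex] δ)
    (hr : MonomialOrder.lex.degree r ≼[MonomialOrder.lex] δ) (hpqr : p + q + r = 0)
    {e : ℕ} (he : e ≠ 0) {m : Fin n →₀ ℕ} (hm : e • δ ≼[MonomialOrder.lex] m) :
    coeff m (p ^ e + q ^ e + r ^ e) = 0 := by
  rcases hm.lt_or_eq with hlt | heq
  · have hz : ∀ p : Poly n, MonomialOrder.lex.degree p ≼[MonomialOrder.lex] δ →
        coeff m (p ^ e) = 0 := fun p hp => by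
      refine MonomialOrder.coeff_eq_zero_of_lt (lt_of_le_of_lt ?_ hlt)
      refine (MonomialOrder.degree_pow_le e).trans ?_
      rw [map_nsmul, map_nsmul]
      exact nsmul_le_nsmul_right hp e
    rw [coeff_add, coeff_add, hz p hp, hz q hq, hz r hr, add_zero, add_zero]
  · have hpow : ∀ x : ZMod 2, x ^ e = x := fun x => by
      rcases eq_or_ne x 0 with rfl | hx
      · exact zero_pow he
      · rw [zmod_two_eq_one hx, one_pow]
    rw [← MonomialOrder.lex.toSyn.injective heq, coeff_add, coeff_add, coeff_nsmul_pow hp,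
      coeff_nsmul_pow hq, coeff_nsmul_pow hr, hpow, hpow, hpow, ← coeff_add, ← coeff_add, hpqr,
      coeff_zero]

theorem coeff_mul_eq_zero_of_le {n : ℕ} {p z : Poly n} {α β m : Fin n →₀ ℕ}
    (hp : MonomialOrder.lex.degree p ≼[MonomialOrder.lex] α)
    (hz : ∀ b, β ≼[MonomialOrder.lex] b → coeff b z = 0)
    (hm : α + β ≼[MonomialOrder.lex] m) : coeff m (p * z) = 0 := by
  rw [coeff_mul]
  refine Finset.sum_eq_zero fun x hx => ?_
  rw [Finset.HasAntidiagonal.mem_antidiagonal] at hx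
  rcases le_or_gt (MonomialOrder.lex.toSyn β) (MonomialOrder.lex.toSyn x.2) with h | h
  · rw [hz _ h, mul_zero]
  · rw [MonomialOrder.coeff_eq_zero_of_lt (lt_of_le_of_lt hp _), zero_mul]
    by_contra! hle
    refine absurd hm (not_le.2 ?_)
    rw [← hx, map_add, map_add]
    exact add_lt_add_of_le_of_lt hle h

/-- The polynomials all of whose translates under `GL_n` have only terms of exponent
lexicographically smaller than `M`. -/
def belowSubmodule {n : ℕ} (M : Fin n →₀ ℕ) : Submodule (ZMod 2) (Poly n) where
  carrier := {f | ∀ (g : GLn n) (m : Fin n →₀ ℕ), M ≼[MonomialOrder.lex] m →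
    coeff m (polyRep n g f) = 0}
  zero_mem' g m _ := by rw [map_zero, coeff_zero]
  add_mem' {a b} ha hb g m hm := by rw [map_add, coeff_add, ha g m hm, hb g m hm, add_zero]
  smul_mem' c a ha g m hm := by rw [map_smul, coeff_smul, ha g m hm, smul_zero]

/-- A product of translates of the `ω_k`, summed over the three flags that differ from the standard
one only in a given step, has no term as large as the leading term of the product. -/
theorem parabolic_sum_omegaMonomial_mem {n : ℕ} (I : Admissible n) {i j : Fin n}
    (hij : (i : ℕ) + 1 = j) (hne : i ≠ j) :
    omegaMonomial I + polyRep n (permElt (Equiv.swap i j)) (omegaMonomial I) +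
      polyRep n (transElt i j hne) (polyRep n (permElt (Equiv.swap i j)) (omegaMonomial I)) ∈
      belowSubmodule I.exponent := by
  intro g m hm
  set s := permElt (Equiv.swap i j)
  set t := transElt i j hne
  have hlt : i < j := by rw [Fin.lt_def]; omega
  set R : Poly n := ∏ k ∈ Finset.univ.erase i, omega n ((k : ℕ) + 1) ^ omegaExp I k with hR
  set w : Poly n := omega n ((i : ℕ) + 1)
  have hfac : omegaMonomial I = R * w ^ omegaExp I i :=
    (Finset.prod_erase_mul _ _ (Finset.mem_univ i)).symm
  have hsR : polyRep n s R = R := by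
    rw [hR, polyRep_prod]
    refine Finset.prod_congr rfl fun k hk => ?_
    have hki : (k : ℕ) ≠ i := fun h => (Finset.mem_erase.1 hk).1 (Fin.ext h)
    rw [polyRep_pow, polyRep_omega_of_stable (permElt_swap_stable hij (by omega))]
  have htR : polyRep n t R = R := by
    rw [hR, polyRep_prod]
    refine Finset.prod_congr rfl fun k hk => ?_
    rw [polyRep_pow, polyRep_omega_of_mem_borel (transElt_mem_borel hlt)]
  have hsum : w + polyRep n s w + polyRep n t (polyRep n s w) = 0 := omega_parabolic_sum hij hne
  have hsplit : ∑ k ∈ Finset.univ.erase i, omegaExp I k • omegaDegree n ((k : ℕ) + 1) +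
      omegaExp I i • omegaDegree n ((i : ℕ) + 1) = I.exponent := by
    rw [Finset.sum_erase_add _ _ (Finset.mem_univ i), sum_omegaExp_smul]
  have hexp : polyRep n g (omegaMonomial I + polyRep n s (omegaMonomial I) +
      polyRep n t (polyRep n s (omegaMonomial I))) =
      polyRep n g R * (polyRep n g w ^ omegaExp I i + polyRep n g (polyRep n s w) ^ omegaExp I i +
        polyRep n g (polyRep n t (polyRep n s w)) ^ omegaExp I i) := by
    simp only [hfac, polyRep_mul, polyRep_pow, hsR, htR, map_add, mul_add]
  rw [hexp]
  have hdeg : ∀ h : GLn n, MonomialOrder.lex.degree (polyRep n h w) ≼[MonomialOrder.lex]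
      omegaDegree n ((i : ℕ) + 1) := lexDegree_polyRep_omega_le (Nat.succ_le_of_lt i.2)
  refine coeff_mul_eq_zero_of_le (?_ : _ ≼[MonomialOrder.lex]
    ∑ k ∈ Finset.univ.erase i, omegaExp I k • omegaDegree n ((k : ℕ) + 1))
    (fun b hb => coeff_sum_pow_eq_zero (hdeg g) ?_ ?_ ?_ (omegaExp_pos I hij) hb)
    (by rw [hsplit]; exact hm)
  · rw [hR, polyRep_prod]
    refine MonomialOrder.degree_prod_le.trans ?_
    rw [map_sum, map_sum]
    refine Finset.sum_le_sum fun k _ => ?_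
    rw [polyRep_pow, MonomialOrder.degree_pow, map_nsmul, map_nsmul]
    exact nsmul_le_nsmul_right (lexDegree_polyRep_omega_le (Nat.succ_le_of_lt k.2) g) _
  · rw [← rep_mul_apply]; exact hdeg _
  · rw [← rep_mul_apply, ← rep_mul_apply]; exact hdeg _
  · rw [← map_add, ← map_add, hsum, map_zero]

theorem polyRep_omegaMonomial_of_mem_borel {n : ℕ} (I : Admissible n) {b : GLn n}
    (hb : b ∈ borel n) : polyRep n b (omegaMonomial I) = omegaMonomial I := by
  rw [omegaMonomial, polyRep_prod]
  refine Finset.prod_congr rfl fun k _ => ?_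
  rw [polyRep_pow, polyRep_omega_of_mem_borel hb]

/-- The element `e_n · ω^I` has the same terms of exponent at least `I` as `ω^I`. -/
theorem coeff_steinbergOp_omegaMonomial {n : ℕ} (I : Admissible n) {m : Fin n →₀ ℕ}
    (hm : I.exponent ≼[MonomialOrder.lex] m) :
    coeff m (steinbergOp n (omegaMonomial I)) = coeff m (omegaMonomial I) := by
  have h := steinberg_sub_mem (polyRep n) (v := omegaMonomial I) (Q := belowSubmodule I.exponent)
    (fun g w hw g' m hm => by rw [← rep_mul_apply]; exact hw _ m hm)
    (fun b hb => polyRep_omegaMonomial_of_mem_borel I hb)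
    (fun i j hij => parabolic_sum_omegaMonomial_mem I hij _)
  have h1 := h 1 m hm
  rw [map_one, Module.End.one_apply, coeff_sub, sub_eq_zero] at h1
  exact h1

theorem coeff_exponent_steinbergOp {n : ℕ} (I : Admissible n) :
    coeff I.exponent (steinbergOp n (omegaMonomial I)) = 1 := by
  rw [coeff_steinbergOp_omegaMonomial I le_rfl, coeff_exponent_omegaMonomial]

theorem coeff_steinbergOp_eq_zero {n : ℕ} (I : Admissible n) {m : Fin n →₀ ℕ}
    (hm : I.exponent ≺[MonomialOrder.lex] m) :
    coeff m (steinbergOp n (omegaMonomial I)) = 0 := by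
  rw [coeff_steinbergOp_omegaMonomial I hm.le]
  exact MonomialOrder.coeff_eq_zero_of_lt (by rwa [lexDegree_omegaMonomial])

/-! ### The basis of the Steinberg summand -/

theorem homogeneousComponent_steinbergOp {n : ℕ} (d : ℕ) (f : Poly n) :
    homogeneousComponent d (steinbergOp n f) = steinbergOp n (homogeneousComponent d f) := by
  simp only [steinbergOp, asAlgebraHom_steinberg, asAlgebraHom_barSum, map_sum,
    polyRep_homogeneousComponent]

theorem steinbergOp_isHomogeneous {n d : ℕ} {f : Poly n} (hf : f.IsHomogeneous d) :
    (steinbergOp n f).IsHomogeneous d := by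
  rw [← homogeneousComponent_eq_self hf, ← homogeneousComponent_steinbergOp]
  exact homogeneousComponent_isHomogeneous _ _

/-- The leading exponent of a homogeneous element of the Steinberg summand is admissible. -/
theorem exists_admissible_eq_lexDegree {n d : ℕ} {f : Poly n} (hf : f ∈ steinbergModule n)
    (hd : f.IsHomogeneous d) (h0 : f ≠ 0) :
    ∃ I : Admissible n, I.exponent = MonomialOrder.lex.degree f := by
  refine exists_admissible_exponent_eq fun i j hij => ?_
  have hlt : i < j := by rw [Fin.lt_def]; omega
  obtain ⟨u, rfl⟩ := hf
  exact two_mul_lexDegree_lt hij hlt.ne hd h0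
    (borel_steinberg (polyRep n) u (transElt_mem_borel hlt))
    (parabolic_sum_steinberg (polyRep n) u hij hlt.ne)

theorem mem_span_of_isHomogeneous {n d : ℕ} {f : Poly n} (hf : f ∈ steinbergModule n)
    (hd : f.IsHomogeneous d) :
    f ∈ Submodule.span (ZMod 2)
      {p : Poly n | ∃ I : Admissible n, I.degree = d ∧
        steinbergOp n (omegaMonomial I) = p} := by
  induction hM : MonomialOrder.lex.toSyn (MonomialOrder.lex.degree f) using
    WellFoundedLT.induction generalizing f with
  | _ M ih =>
  rcases eq_or_ne f 0 with rfl | h0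
  · exact Submodule.zero_mem _
  obtain ⟨I, hI⟩ := exists_admissible_eq_lexDegree hf hd h0
  have hId : I.degree = d := by
    rw [← I.degree_exponent, hI]
    exact degree_eq_of_mem_support hd (MonomialOrder.degree_mem_support h0)
  set E := steinbergOp n (omegaMonomial I)
  have hEspan : E ∈ Submodule.span (ZMod 2)
      {p : Poly n | ∃ I : Admissible n, I.degree = d ∧
        steinbergOp n (omegaMonomial I) = p} := Submodule.subset_span ⟨I, hId, rfl⟩
  rw [← sub_add_cancel f E]
  refine Submodule.add_mem _ ?_ hEspan
  rcases eq_or_ne (f - E) 0 with hz | hz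
  · rw [hz]; exact Submodule.zero_mem _
  refine ih _ ?_ (Submodule.sub_mem _ hf ⟨_, rfl⟩)
    (hd.sub (hId ▸ steinbergOp_isHomogeneous (omegaMonomial_isHomogeneous I))) rfl
  rw [← hM]
  by_contra! hle
  refine MonomialOrder.coeff_degree_ne_zero_iff (m := MonomialOrder.lex).2 hz ?_
  rw [coeff_sub]
  rcases hle.lt_or_eq with hlt | heq
  · rw [MonomialOrder.coeff_eq_zero_of_lt hlt, coeff_steinbergOp_eq_zero I (by rwa [hI]),
      sub_zero]
  · rw [← MonomialOrder.lex.toSyn.injective heq,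
      zmod_two_eq_one (MonomialOrder.coeff_degree_ne_zero_iff.2 h0), ← hI,
      coeff_exponent_steinbergOp, sub_self]

theorem linearIndependent_steinbergOp (n : ℕ) :
    LinearIndependent (ZMod 2)
      fun I : Admissible n => steinbergOp n (omegaMonomial I) := by
  classical
  rw [linearIndependent_iff']
  intro s c hc I₀ hI₀
  by_contra hne
  obtain ⟨I, hI, hmax⟩ := Finset.exists_max_image (s.filter fun I => c I ≠ 0)
    (fun I => MonomialOrder.lex.toSyn I.exponent) ⟨I₀, Finset.mem_filter.2 ⟨hI₀, hne⟩⟩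
  rw [Finset.mem_filter] at hI
  have h := congrArg (coeff I.exponent) hc
  rw [coeff_sum, coeff_zero, Finset.sum_eq_single I] at h
  · rw [coeff_smul, coeff_exponent_steinbergOp, smul_eq_mul, mul_one] at h
    exact hI.2 h
  · intro J hJ hJI
    rw [coeff_smul]
    rcases eq_or_ne (c J) 0 with h0 | h0
    · rw [h0, zero_smul]
    · rw [coeff_steinbergOp_eq_zero J, smul_zero]
      refine lt_of_le_of_ne (hmax J (Finset.mem_filter.2 ⟨hJ, h0⟩)) fun h => hJI ?_
      exact Admissible.exponent_injective (MonomialOrder.lex.toSyn.injective h)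
  · exact fun h => absurd hI.1 h

theorem span_steinbergOp (n : ℕ) :
    Submodule.span (ZMod 2) (Set.range fun I : Admissible n => steinbergOp n (omegaMonomial I)) =
      steinbergModule n := by
  apply le_antisymm
  · rw [Submodule.span_le]
    rintro _ ⟨I, rfl⟩
    exact ⟨_, rfl⟩
  · rintro _ ⟨u, rfl⟩
    rw [← sum_homogeneousComponent (steinbergOp n u)]
    refine Submodule.sum_mem _ fun d _ => ?_
    have hmem : homogeneousComponent d (steinbergOp n u) ∈ steinbergModule n :=
      ⟨_, (homogeneousComponent_steinbergOp d u).symm⟩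
    refine Submodule.span_mono ?_
      (mem_span_of_isHomogeneous hmem (homogeneousComponent_isHomogeneous d _))
    rintro _ ⟨I, -, rfl⟩
    exact ⟨I, rfl⟩

end SteinbergSummand

end

theorem mainTheorem8 (n : ℕ) :
    ∃ b : Module.Basis (SteinbergSummand.Admissible n) (ZMod 2)
        (SteinbergSummand.steinbergModule n),
      (∀ I : SteinbergSummand.Admissible n,
        (b I : MvPolynomial (Fin n) (ZMod 2)) =
          SteinbergSummand.steinbergOp n (SteinbergSummand.omegaMonomial I)) ∧
      (∀ I : SteinbergSummand.Admissible n,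
        (b I : MvPolynomial (Fin n) (ZMod 2)).IsHomogeneous I.degree) ∧
      (∀ d : ℕ,
        Submodule.span (ZMod 2)
            {f : MvPolynomial (Fin n) (ZMod 2) |
              ∃ I : SteinbergSummand.Admissible n, I.degree = d ∧
                (b I : MvPolynomial (Fin n) (ZMod 2)) = f} =
          SteinbergSummand.steinbergModule n ⊓
            MvPolynomial.homogeneousSubmodule (Fin n) (ZMod 2) d) := by
  open SteinbergSummand in
  have hb : ∀ I : Admissible n,
      (((Module.Basis.span (linearIndependent_steinbergOp n)).map
        (LinearEquiv.ofEq _ _ (span_steinbergOp n))) I : Poly n) =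
      steinbergOp n (omegaMonomial I) := fun I => by
    rw [Module.Basis.map_apply, LinearEquiv.coe_ofEq_apply, Module.Basis.span_apply]
  refine ⟨_, hb, fun I => ?_, fun d => ?_⟩
  · rw [hb]
    exact SteinbergSummand.steinbergOp_isHomogeneous
      (SteinbergSummand.omegaMonomial_isHomogeneous I)
  · simp only [hb]
    apply le_antisymm
    · rw [Submodule.span_le]
      rintro _ ⟨I, rfl, rfl⟩
      exact ⟨⟨_, rfl⟩, SteinbergSummand.steinbergOp_isHomogeneous
        (SteinbergSummand.omegaMonomial_isHomogeneous I)⟩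
    · rintro f ⟨hf, hd⟩
      exact SteinbergSummand.mem_span_of_isHomogeneous hf hd
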